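/- Let $k$ be an algebraically closed field of characteristic $p\ge 5$ and let $X\to\mathbb P^1$ be a Harbater–Katz–Gabber cover over $k$ with group a finite $p$-group $G$: a Galois cover with group $G$, totally ramified at one point $P\in X$ and unramified elsewhere. Put $F=k(X)$, so that $F^G$ is a rational function field. Let $0=m_0<m_1<\cdots$ be the pole numbers at $P$ (the $m$ for which some $f\in F$ has $(f)_\infty=mP$), let $\rho_i$ be the representation of $G$ on $L(m_iP)$, and let $c_1<\dots<c_n$ be the indices $i$ with $\ker\rho_{i+1}\subsetneq\ker\rho_i$. Put $F_i=F^{\ker\rho_{c_i}}$ and $\bar m_i=m_{c_i+1}$ for $1\le i\le n$, and $F_{n+1}=F$. Choose $\bar f_0$ with its only pole at $P$ and $F^G=k(\bar f_0)$, and $\bar f_i$ with $(\bar f_i)_\infty=\bar m_iP$ for $1\le i\le n$. Then $F_1=F^G=k(\bar f_0)$, and for every $1\le i\le n$ the following hold. (1) $L((\bar m_i-1)P)\subset F_i$, and $F_{i+1}=F_i(\bar f_i)$ is elementary abelian over $F_i$ of degree $p^{n_i}$ with $n_i\ge 1$. The function $\bar C_i(\sigma)=\sigma(\bar f_i)-\bar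 f_i$ is a $1$-cocycle on $\mathrm{Gal}(F_{i+1}/F_1)$ with values in the stable subspace $L((\bar m_i-1)P)$. Its restriction to $\mathrm{Gal}(F_{i+1}/F_i)$ is an injective homomorphism, is the only cocycle in its class in $H^1(\mathrm{Gal}(F_{i+1}/F_i),L((\bar m_i-1)P))$, and defines the polynomial $$P_i(Y)=\prod_{a\in W_i}(Y-a),\qquad W_i=\bar C_i(\mathrm{Gal}(F_{i+1}/F_i)).$$ This polynomial is additive, $P_i(Y)=Y^{p^{n_i}}+\sum_{j<n_i}a_jY^{p^j}$, with $a_j\in k[\bar f_0]$, and $a_j\in k$ if $W_i\subset k$. (2) $P_i$ induces a map $$H^1\big(\mathrm{Gal}(F_{i+1}/F_1),L((\bar m_i-1)P)\big)\to H^1\big(\mathrm{Gal}(F_{i+1}/F_1),F_i\cap L(p^{n_i}\bar m_iP)\big),\quad [d]\mapsto[P_i(d)],$$ and the class of $\bar C_i$ lies in its kernel. The element $D_i=P_i(\bar f_i)$ lies in $F_i\cap L(p^{n_i}\bar m_iP)$ and expresses $P_i(\bar C_i)$ as a coboundary: $P_i(\bar C_i(\sigma))=\sigma(D_i)-D_i$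 for all $\sigma\in \mathrm{Gal}(F_{i+1}/F_1)$. An element $D\in F_i\cap L(p^{n_i}\bar m_iP)$ has this property if and only if $D-D_i\in k[\bar f_0]$. (3) The extension $F_{i+1}/F_i$ and the action of $\mathrm{Gal}(F_{i+1}/F_1)$ on it are determined by $P_i$, $D_i$ and the cocycle. The polynomial $P_i(Y)-D_i$ has coefficients in $F_i$ and is irreducible over $F_i$. For every field extension $K=F_i(z)$ with $P_i(z)=D_i$ there is a unique isomorphism $F_{i+1}\to K$ over $F_i$ with $\bar f_i\mapsto z$. Every $\sigma\in\mathrm{Gal}(F_{i+1}/F_1)$ restricts to an element of $\mathrm{Gal}(F_i/F_1)$, and for all $\tau\in\mathrm{Gal}(F_i/F_1)$ and $e\in F_i$ with $P_i(e)=\tau(D_i)-D_i$ there is exactly one $\sigma\in\mathrm{Gal}(F_{i+1}/F_1)$ with $\sigma|_{F_i}=\tau$ and $\bar C_i(\sigma)=e$. -/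

import Mathlib

open Polynomial

universe u v

namespace HKG

/-- A place of a function field `F / k` of one variable (equivalently, a point of the smooth
projective model): a normalized discrete valuation of `F` that is trivial on `k`, written
multiplicatively, so that `val f = WithZero.exp m` with `m > 0` means a pole of order `m`. -/
@[ext]
structure Place (k : Type v) (F : Type u) [Field k] [Field F] [Algebra k F] where
  val : Valuation F (WithZero (Multiplicative ℤ))
  surjective : Function.Surjective val
  trivial : ∀ c : k, val (algebraMap k F c) ≤ 1

/-- `σ` lies in the inertia group of `Q`: it fixes the place `Q` and acts trivially on its
residue field. -/
def Place.IsInertial {k : Type v} {F : Type u} [Field k] [Field F] [Algebra k F]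
    (Q : Place k F) (σ : F ≃ₐ[k] F) : Prop :=
  (∀ f : F, Q.val (σ f) = Q.val f) ∧ ∀ f : F, Q.val f ≤ 1 → Q.val (σ f - f) < 1

/-- A Harbater-Katz-Gabber cover `X → ℙ¹` whose group is a `p`-group, in terms of the function
field `F = k(X)`: a finite `p`-group `G` of automorphisms of `F / k` whose fixed field is a
rational function field, totally ramified at `P`, and unramified at all other places. -/
structure Cover (p : ℕ) (k : Type v) (F : Type u) [Field k] [Field F] [Algebra k F] where
  G : Subgroup (F ≃ₐ[k] F)
  P : Place k F
  finite : Finite G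
  isPGroup : IsPGroup p G
  rational : ∃ x : F, Transcendental k x ∧
    IntermediateField.fixedField G = IntermediateField.adjoin k {x}
  totallyRamified : ∀ σ ∈ G, P.IsInertial σ
  unramified : ∀ Q : Place k F, Q ≠ P → ∀ σ ∈ G, Q.IsInertial σ → σ = 1

noncomputable section

namespace Cover

variable {p : ℕ} {k : Type v} {F : Type u} [Field k] [Field F] [Algebra k F] (X : Cover p k F)

/-- The Riemann-Roch space `L(mP)`. -/
def L (m : ℕ) : Submodule k F where
  carrier := {f | X.P.val f ≤ WithZero.exp (m : ℤ) ∧ ∀ Q : Place k F, Q ≠ X.P → Q.val f ≤ 1}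
  zero_mem' := by simp
  add_mem' := by
    rintro f g ⟨hf, hf'⟩ ⟨hg, hg'⟩
    exact ⟨X.P.val.map_add_le hf hg, fun Q hQ => Q.val.map_add_le (hf' Q hQ) (hg' Q hQ)⟩
  smul_mem' := by
    rintro c f ⟨hf, hf'⟩
    refine ⟨?_, fun Q hQ => ?_⟩
    · rw [Algebra.smul_def, map_mul]
      exact (mul_le_of_le_one_left' (X.P.trivial c)).trans hf
    · rw [Algebra.smul_def, map_mul]
      exact (mul_le_of_le_one_left' (Q.trivial c)).trans (hf' Q hQ)

/-- `f` is regular outside `P` and has a pole of order exactly `m` at `P`: `(f)_∞ = m P`. -/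
def HasPole (f : F) (m : ℕ) : Prop :=
  f ∈ X.L m ∧ X.P.val f = WithZero.exp (m : ℤ)

/-- The `i`-th element `m_i` of the Weierstrass semigroup `H(P)`, with `m_0 = 0`. -/
def poleNumber (i : ℕ) : ℕ :=
  Nat.nth (fun m => ∃ f : F, X.HasPole f m) i

/-- The kernel of the representation `ρ_i` of `G` on `L(m_i P)`. -/
def kerRho (i : ℕ) : Subgroup (F ≃ₐ[k] F) :=
  X.G ⊓ fixingSubgroup (F ≃ₐ[k] F) (X.L (X.poleNumber i) : Set F)

/-- `i` is a jump of the representation filtration. -/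
def IsJump (i : ℕ) : Prop := X.kerRho (i + 1) < X.kerRho i

/-- The number `n` of jumps of the representation filtration. -/
def numJumps : ℕ := Set.ncard {i | X.IsJump i}

/-- The jumps `c_1 < ⋯ < c_n` of the representation filtration. -/
def jump (i : ℕ) : ℕ := Nat.nth X.IsJump (i - 1)

/-- The tower `F_1 ⊆ ⋯ ⊆ F_{n+1} = F`, where `F_i` is the fixed field of the kernel of `ρ_{c_i}`
for `1 ≤ i ≤ n`. -/
def tower (i : ℕ) : IntermediateField k F :=
  if i ≤ X.numJumps then IntermediateField.fixedField (X.kerRho (X.jump i)) else ⊤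

/-- The pole number `m̄_i = m_{c_i + 1}`. -/
def mbar (i : ℕ) : ℕ := X.poleNumber (X.jump i + 1)

/-- The Galois group `Gal(F_j / F_i)`, for `i ≤ j`: the automorphisms of `F_j` fixing `F_i`. -/
def gal (j i : ℕ) : Subgroup (X.tower j ≃ₐ[k] X.tower j) :=
  ((X.tower i).comap (X.tower j).val).fixingSubgroup

/-- The functions in `F_i ∩ L(mP)`, regarded as elements of `F_{i+1}`. -/
def space (i m : ℕ) : AddSubgroup (X.tower (i + 1)) where
  carrier := {a | (a : F) ∈ X.tower i ∧ (a : F) ∈ X.L m}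
  zero_mem' := ⟨zero_mem _, zero_mem _⟩
  add_mem' := fun ha hb => ⟨add_mem ha.1 hb.1, add_mem ha.2 hb.2⟩
  neg_mem' := fun ha => ⟨neg_mem ha.1, neg_mem ha.2⟩

/-- A choice of `f̄_0, …, f̄_n`: `f̄_0` is a generator of the rational function field
`F ^ G` with its pole at `P`, and `(f̄_i)_∞ = m̄_i P` for `1 ≤ i ≤ n`. -/
structure IsGeneratorSystem (f : ℕ → F) : Prop where
  base : IntermediateField.fixedField X.G = IntermediateField.adjoin k {f 0}
  base_regular : ∀ Q : Place k F, Q ≠ X.P → Q.val (f 0) ≤ 1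
  pole : ∀ i, 1 ≤ i → i ≤ X.numJumps → X.HasPole (f i) (X.mbar i)

end Cover

section Cohomology

variable {k : Type v} {E : Type u} [Field k] [Field E] [Algebra k E]

/-- The subgroup `M` of `E` is stable under the group `Γ` of automorphisms. -/
def IsStable (Γ : Subgroup (E ≃ₐ[k] E)) (M : AddSubgroup E) : Prop :=
  ∀ σ ∈ Γ, ∀ a ∈ M, σ a ∈ M

/-- The `Γ`-module `M`, as a representation over `ℤ` (lifted to the universe of `E`). -/
def galRep (Γ : Subgroup (E ≃ₐ[k] E)) (M : AddSubgroup E) (hM : IsStable Γ M) :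
    Rep.{u} (ULift.{u} ℤ) Γ :=
  Rep.of (X := M)
    { toFun := fun σ =>
        { toFun := fun a => ⟨(σ : E ≃ₐ[k] E) a, hM σ σ.2 a a.2⟩
          map_add' := fun a b => Subtype.ext (map_add (σ : E ≃ₐ[k] E) (a : E) b)
          map_smul' := fun n a => Subtype.ext (map_zsmul (σ : E ≃ₐ[k] E) n.down (a : E)) }
      map_one' := rfl
      map_mul' := fun _ _ => rfl }

/-- The 1-cocycles of `Γ` with values in `M`. -/
abbrev Z1 (Γ : Subgroup (E ≃ₐ[k] E)) (M : AddSubgroup E) (hM : IsStable Γ M) : Type u :=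
  groupCohomology.cocycles₁ (galRep Γ M hM)

/-- The value of a 1-cocycle, as an element of `E`. -/
def Z1.value {Γ : Subgroup (E ≃ₐ[k] E)} {M : AddSubgroup E} {hM : IsStable Γ M}
    (c : Z1 Γ M hM) (σ : Γ) : E :=
  let a : M := c.1 σ
  a

/-- The class in `H¹(Γ, M)` of a 1-cocycle. -/
def Z1.cls {Γ : Subgroup (E ≃ₐ[k] E)} {M : AddSubgroup E} {hM : IsStable Γ M}
    (c : Z1 Γ M hM) : groupCohomology.H1 (galRep Γ M hM) :=
  (groupCohomology.H1π (galRep Γ M hM)).hom c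

/-- The polynomial `Q` is additive, commutes with `Γ`, and maps `M` to `M'`. -/
structure Induces (Q : E[X]) (Γ : Subgroup (E ≃ₐ[k] E)) (M M' : AddSubgroup E) : Prop where
  additive : ∀ a b : E, Q.eval (a + b) = Q.eval a + Q.eval b
  equivariant : ∀ σ ∈ Γ, ∀ a : E, Q.eval (σ a) = σ (Q.eval a)
  mapsTo : ∀ a ∈ M, Q.eval a ∈ M'

/-- The morphism of `Γ`-modules `a ↦ Q(a)` from `M` to `M'`. -/
def polyHom {Q : E[X]} {Γ : Subgroup (E ≃ₐ[k] E)} {M M' : AddSubgroup E}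
    (hM : IsStable Γ M) (hM' : IsStable Γ M') (hQ : Induces Q Γ M M') :
    galRep Γ M hM ⟶ galRep Γ M' hM' :=
  Rep.ofHom
    { toFun := fun a : M => (⟨Q.eval (a : E), hQ.mapsTo a a.2⟩ : M')
      map_add' := fun a b => Subtype.ext (hQ.additive a b)
      map_smul' := fun n a => map_zsmul
        (AddMonoidHom.mk' (fun a : M => (⟨Q.eval (a : E), hQ.mapsTo a a.2⟩ : M'))
          fun a b => Subtype.ext (hQ.additive a b)) n.down a
      isIntertwining' := fun σ => LinearMap.ext fun a =>
        Subtype.ext (hQ.equivariant σ σ.2 (a : E)) }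

/-- The map `H¹(Γ, M) → H¹(Γ, M')` induced by an additive polynomial, `[d] ↦ [Q(d)]`. -/
def polyH1 {Q : E[X]} {Γ : Subgroup (E ≃ₐ[k] E)} {M M' : AddSubgroup E}
    (hM : IsStable Γ M) (hM' : IsStable Γ M') (hQ : Induces Q Γ M M') :
    groupCohomology.H1 (galRep Γ M hM) → groupCohomology.H1 (galRep Γ M' hM') :=
  ((groupCohomology.functor (ULift.{u} ℤ) Γ 1).map (polyHom hM hM' hQ)).hom

/-- The monic polynomial `∏ (Y - a)`, over the set of values `a` of a 1-cocycle. -/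
def valuePoly {Γ : Subgroup (E ≃ₐ[k] E)} {M : AddSubgroup E} {hM : IsStable Γ M}
    (c : Z1 Γ M hM) : E[X] :=
  ∏ᶠ a ∈ Set.range c.value, (X - C a)

end Cohomology

end

end HKG

/-!
Write `x = f̄_0`, so that `F ^ G = k(x)`. The argument has an arithmetic and a Galois-theoretic
part.

*Arithmetic.* The integral closure of `k[x]` in `F` is a Dedekind domain whose maximal ideals give
places of `F`. Since `x` is not integral over `k[x⁻¹]`, the same fact for `x⁻¹` shows that `x` has
a pole at some place, which must be `P`; thus the functions regular outside `P` are exactly those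
integral over `k[x]` (`Cover.isIntegral_iff`). Everything at `P` follows from norms: as `P` is
totally ramified, a product of conjugates of a unit `u` is congruent to a power of `u`, and the
relevant exponents are powers of `p`. Applied to `G` this shows that the residue field at `P` is
`k` (`Cover.exists_val_sub_lt`), so that `L(m P)` is spanned by `L((m - 1) P)` and any one function
with pole divisor `m P`. Applied to the powers of one `σ ∈ G` it shows that `σ` acts trivially on
leading terms at `P` (`Cover.val_apply_sub_lt`), so that `σ f̄_i - f̄_i` lies in `L((m̄_i - 1) P)`.

*Galois theory.* By Artin's theorem the finite subgroups of `Aut_k(F)` correspond to their fixed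
fields. The space `L((m̄_i - 1) P) = L(m_{c_i} P)` is fixed by `ker ρ_{c_i}`, hence contained in
`F_i`, and an element of `ker ρ_{c_i}` lies in `ker ρ_{c_i + 1}` if and only if it fixes `f̄_i`
(`Cover.mem_towerGroup_succ_iff`). Therefore `F_{i+1} = F_i(f̄_i)`, and `σ ↦ σ f̄_i - f̄_i` is an
injective homomorphism from `Gal(F_{i+1} / F_i)` to the additive group of `F_i`. Its image `W_i` is
a finite group stable under `G`. The polynomial `P_i` with roots `W_i` is additive
(`exists_finprod_eq_additivePoly`) with coefficients in `F ^ G` that are integral over `k[x]`,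
hence in `k[x]`. Additivity gives `P_i(σ f̄_i - f̄_i) = σ D_i - D_i` for `D_i = P_i(f̄_i)`. The
`p ^ {n_i}` conjugates `f̄_i + w` of `f̄_i` are roots of `P_i(Y) - D_i`, which is therefore the
minimal polynomial of `f̄_i` over `F_i`; the remaining claims express that two solutions of
`P_i(e) = τ(D_i) - D_i` differ by an element of `W_i`.
-/

namespace HKG

/-! ### Galois theory of a finite group of automorphisms -/

section Galois

open IntermediateField

variable {k : Type v} {F : Type u} [Field k] [Field F] [Algebra k F]
  (H : Subgroup (F ≃ₐ[k] F)) [Finite H]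

theorem isGalois_fixedField : IsGalois (fixedField H) F :=
  inferInstanceAs (IsGalois (FixedPoints.subfield H F) F)

theorem finiteDimensional_fixedField : FiniteDimensional (fixedField H) F :=
  inferInstanceAs (FiniteDimensional (FixedPoints.subfield H F) F)

variable {H}

theorem isGalois_of_fixedField_le {K : IntermediateField k F} (hK : fixedField H ≤ K) :
    IsGalois K F :=
  have := isGalois_fixedField H
  inferInstanceAs (IsGalois (extendScalars hK) F)

theorem finiteDimensional_of_fixedField_le {K : IntermediateField k F} (hK : fixedField H ≤ K) :
    FiniteDimensional K F :=
  have := finiteDimensional_fixedField H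
  inferInstanceAs (FiniteDimensional (extendScalars hK) F)

/-- An embedding into `F` of an intermediate field `K ⊇ F ^ H` that fixes `F ^ H` is induced by an
element of the finite group `H`: it extends to `F` by normality, and `Gal(F / F ^ H) = H` by
Artin's theorem. -/
theorem exists_mem_extending {K : IntermediateField k F} (hK : fixedField H ≤ K) (φ : K →+* F)
    (hφ : ∀ a : K, (a : F) ∈ fixedField H → φ a = a) : ∃ h ∈ H, ∀ a : K, h (a : F) = φ a := by
  have := isGalois_fixedField H
  let K' := extendScalars hK
  let φ' : K' →ₐ[fixedField H] F :=
    { (φ : K' →+* F) with commutes' := fun a => hφ ⟨a, hK a.2⟩ a.2 }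
  obtain ⟨h, hh⟩ := (FixedPoints.toAlgHom_bijective H F).surjective (φ'.liftNormal F)
  refine ⟨h, h.2, fun a => ?_⟩
  have := φ'.liftNormal_commutes F (a : K')
  exact (DFunLike.congr_fun hh (a : F)).trans this

/-- An element fixed by all elements of `H` that fix `K ⊇ F ^ H` lies in `K`. -/
theorem mem_of_forall_fixed {K : IntermediateField k F} (hK : fixedField H ≤ K) {a : F}
    (ha : ∀ h ∈ H, (∀ b ∈ K, h b = b) → h a = a) : a ∈ K := by
  have := isGalois_of_fixedField_le hK
  have := finiteDimensional_of_fixedField_le hK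
  have : a ∈ (⊥ : IntermediateField K F) := by
    rw [IsGalois.mem_bot_iff_fixed]
    intro φ
    obtain ⟨h, hH, hh⟩ := exists_mem_extending (H := H) (K := ⊤) le_top
      ((φ : F →+* F).comp (algebraMap (⊤ : IntermediateField k F) F))
      fun b hb => φ.commutes ⟨b, hK hb⟩
    have e : ∀ b, h b = φ b := fun b => hh ⟨b, trivial⟩
    rw [← e]
    exact ha h hH fun b hb => (e b).trans (φ.commutes ⟨b, hb⟩)
  obtain ⟨b, rfl⟩ := mem_bot.1 this
  exact b.2

end Galois

/-! ### Places and the affine coordinate ring -/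

section Place

open IntermediateField

variable {k : Type v} {F : Type u} [Field k] [Field F] [Algebra k F]

theorem Place.val_algebraMap (Q : Place k F) {c : k} (hc : c ≠ 0) :
    Q.val (algebraMap k F c) = 1 := by
  refine (Q.trivial c).antisymm ?_
  have h := Q.trivial c⁻¹
  rw [map_inv₀, map_inv₀] at h
  exact (inv_le_one₀ (by simpa [zero_lt_iff] using hc)).1 h

instance (Q : Place k F) : Q.val.IsTrivialOn k where
  eq_one _ hc := Q.val_algebraMap hc

theorem Place.val_le_one_of_mem_adjoin (Q : Place k F) {x a : F} (hx : Q.val x ≤ 1)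
    (ha : a ∈ Algebra.adjoin k {x}) : Q.val a ≤ 1 := by
  let S : Subalgebra k F := { Q.val.integer with algebraMap_mem' := Q.trivial }
  exact (Algebra.adjoin_le (S := S) (Set.singleton_subset_iff.2 hx)) ha

theorem Place.val_le_one_of_isIntegral (Q : Place k F) {x f : F} (hx : Q.val x ≤ 1)
    (hf : IsIntegral (Algebra.adjoin k {x}) f) : Q.val f ≤ 1 := by
  let j : Algebra.adjoin k {x} →+* Q.val.integer :=
    (Algebra.adjoin k {x}).val.toRingHom.codRestrict Q.val.integer
      fun a => Q.val_le_one_of_mem_adjoin hx a.2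
  have : IsIntegral Q.val.integer f := by
    obtain ⟨q, hq, h⟩ := hf
    exact ⟨q.map j, hq.map j, by rw [eval₂_map]; exact h⟩
  exact (Valuation.integer.integers Q.val).mem_of_integral this

theorem isPrincipalIdealRing_adjoin (x : F) : IsPrincipalIdealRing (Algebra.adjoin k {x}) := by
  rw [Algebra.adjoin_singleton_eq_range_aeval]
  exact .of_surjective (aeval (R := k) x).rangeRestrict (AlgHom.rangeRestrict_surjective _)

open IntermediateField.algebraAdjoinAdjoin in
/-- The places of `F` that are finite over `k[x]` cut out the integral closure of `k[x]` in `F`: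
they include the maximal ideals of this Dedekind domain. -/
theorem exists_place_of_not_isIntegral {x f : F} (h₁ : FiniteDimensional k⟮x⟯ F)
    (h₂ : Algebra.IsSeparable k⟮x⟯ F) (hf : ¬ IsIntegral (Algebra.adjoin k {x}) f) :
    ∃ Q : Place k F, Q.val x ≤ 1 ∧ 1 < Q.val f := by
  have := isPrincipalIdealRing_adjoin (k := k) x
  let A := Algebra.adjoin k {x}
  let B := integralClosure A F
  have : IsDedekindDomain B := integralClosure.isDedekindDomain A k⟮x⟯ F
  have : IsFractionRing B F := integralClosure.isFractionRing_of_finite_extension k⟮x⟯ F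
  by_contra! hQ
  refine hf ?_
  have key : f ∈ (algebraMap B F).range := by
    refine IsDedekindDomain.HeightOneSpectrum.mem_integers_of_valuation_le_one F f fun w => ?_
    have hw : ∀ a : A, w.valuation F (a : F) ≤ 1 := fun a =>
      w.valuation_le_one (algebraMap A B a)
    exact hQ ⟨w.valuation F, w.valuation_surjective F,
      fun c => hw (algebraMap k A c)⟩ (hw ⟨x, Algebra.self_mem_adjoin_singleton k x⟩)
  obtain ⟨b, rfl⟩ := key
  exact b.2

open IntermediateField.algebraAdjoinAdjoin in
theorem exists_mul_isIntegral {x : F} (h₁ : FiniteDimensional k⟮x⟯ F) (f : F) :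
    ∃ a b : F, b ≠ 0 ∧ IsIntegral (Algebra.adjoin k {x}) a ∧ IsIntegral (Algebra.adjoin k {x}) b ∧
      f * b = a := by
  have : IsFractionRing (integralClosure (Algebra.adjoin k {x}) F) F :=
    integralClosure.isFractionRing_of_finite_extension k⟮x⟯ F
  obtain ⟨a, b, hb, rfl⟩ := IsFractionRing.div_surjective
    (A := integralClosure (Algebra.adjoin k {x}) F) f
  have hb' : (b : F) ≠ 0 := by simpa using nonZeroDivisors.ne_zero hb
  exact ⟨a, b, hb', a.2, b.2, div_mul_cancel₀ _ hb'⟩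

open IntermediateField.algebraAdjoinAdjoin in
theorem mem_adjoin_of_isIntegral {x a : F} (ha : a ∈ k⟮x⟯)
    (hi : IsIntegral (Algebra.adjoin k {x}) a) : a ∈ Algebra.adjoin k {x} := by
  have := isPrincipalIdealRing_adjoin (k := k) x
  have h : IsIntegral (Algebra.adjoin k {x}) (⟨a, ha⟩ : k⟮x⟯) :=
    (isIntegral_algHom_iff (IsScalarTower.toAlgHom (Algebra.adjoin k {x}) k⟮x⟯ F)
      (algebraMap k⟮x⟯ F).injective).1 hi
  obtain ⟨b, hb⟩ := IsIntegrallyClosed.isIntegral_iff.1 h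
  have : (b : F) = a := congr_arg Subtype.val hb
  exact this ▸ b.2

theorem not_isIntegral_adjoin_inv {x : F} (hx : Transcendental k x) :
    ¬ IsIntegral (Algebra.adjoin k {x⁻¹}) x := fun hi => by
  have h0 : x ≠ 0 := fun h => hx (h ▸ isAlgebraic_zero)
  have hm := mem_adjoin_of_isIntegral
    (by simpa using inv_mem (mem_adjoin_simple_self k x⁻¹)) hi
  rw [Algebra.adjoin_singleton_eq_range_aeval] at hm
  obtain ⟨q, hq⟩ := hm
  have hq : aeval x⁻¹ q = x := hq
  have hinv : Transcendental k x⁻¹ := fun h => hx (IsAlgebraic.inv_iff.1 h)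
  have h1 : aeval x⁻¹ (X * q - 1 : k[X]) = 0 := by
    rw [map_sub, map_mul, aeval_X, map_one, hq, inv_mul_cancel₀ h0, sub_self]
  have h2 := (transcendental_iff.1 hinv) _ h1
  exact not_isUnit_X (isUnit_iff_exists_inv.2 ⟨q, sub_eq_zero.1 h2⟩)

/-- A transcendental `x` has a pole somewhere, as it is not integral over `k[x⁻¹]`. -/
theorem exists_place_one_lt {x : F} (hx : Transcendental k x) (h₁ : FiniteDimensional k⟮x⟯ F)
    (h₂ : Algebra.IsSeparable k⟮x⟯ F) : ∃ Q : Place k F, 1 < Q.val x := by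
  have e : k⟮x⟯ = k⟮x⁻¹⟯ := by
    apply le_antisymm <;> rw [adjoin_simple_le_iff]
    · simpa using inv_mem (mem_adjoin_simple_self k x⁻¹)
    · exact inv_mem (mem_adjoin_simple_self k x)
  rw [e] at h₁ h₂
  obtain ⟨Q, -, hQ⟩ := exists_place_of_not_isIntegral h₁ h₂ (not_isIntegral_adjoin_inv hx)
  exact ⟨Q, hQ⟩

end Place

/-! ### Arithmetic at the totally ramified point -/

namespace Cover

open IntermediateField

variable {p : ℕ} {k : Type v} {F : Type u} [Field k] [Field F] [Algebra k F] (cov : Cover p k F)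

theorem L_mono {m n : ℕ} (h : m ≤ n) : cov.L m ≤ cov.L n := fun _ hf =>
  ⟨hf.1.trans (by simpa using h), hf.2⟩

theorem mul_mem_L {m n : ℕ} {f g : F} (hf : f ∈ cov.L m) (hg : g ∈ cov.L n) :
    f * g ∈ cov.L (m + n) := by
  refine ⟨?_, fun Q hQ => ?_⟩
  · rw [map_mul, Nat.cast_add, WithZero.exp_add]
    exact mul_le_mul' hf.1 hg.1
  · rw [map_mul]
    exact mul_le_one' (hf.2 Q hQ) (hg.2 Q hQ)

theorem one_mem_L : (1 : F) ∈ cov.L 0 := ⟨by simp, fun Q _ => by simp⟩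

theorem algebraMap_mem_L (c : k) (m : ℕ) : algebraMap k F c ∈ cov.L m := by
  rw [Algebra.algebraMap_eq_smul_one]
  exact Submodule.smul_mem _ _ (cov.L_mono (Nat.zero_le m) cov.one_mem_L)

theorem poleNumber_zero : cov.poleNumber 0 = 0 :=
  Nat.nth_zero_of_zero ⟨1, cov.one_mem_L, by simp⟩

theorem prod_mem_L {ι : Type*} {m : ℕ} (s : Finset ι) {f : ι → F} (hf : ∀ i ∈ s, f i ∈ cov.L m) :
    ∏ i ∈ s, f i ∈ cov.L (s.card * m) := by
  classical
  induction s using Finset.induction_on with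
  | empty => simpa using cov.one_mem_L
  | insert a s ha ih =>
    rw [Finset.prod_insert ha, Finset.card_insert_of_notMem ha, add_mul, one_mul, add_comm]
    exact cov.mul_mem_L (hf a (Finset.mem_insert_self a s))
      (ih fun i hi => hf i (Finset.mem_insert_of_mem hi))

theorem val_apply {σ : F ≃ₐ[k] F} (hσ : σ ∈ cov.G) (f : F) : cov.P.val (σ f) = cov.P.val f :=
  (cov.totallyRamified σ hσ).1 f

/-- The Riemann-Roch spaces at `P` are stable under `G`, which permutes the places other
than `P`. -/
theorem apply_mem_L {σ : F ≃ₐ[k] F} (hσ : σ ∈ cov.G) {m : ℕ} {f : F} (hf : f ∈ cov.L m) :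
    σ f ∈ cov.L m := by
  refine ⟨(cov.val_apply hσ f).trans_le hf.1, fun Q hQ => ?_⟩
  let Q' : Place k F := ⟨Q.val.comap (σ : F →+* F), Q.surjective.comp σ.surjective,
    fun c => by simp⟩
  refine hf.2 Q' fun h => hQ ?_
  ext a
  have h1 : Q'.val (σ⁻¹ a) = Q.val a := congr_arg Q.val (σ.apply_symm_apply a)
  rw [← h1, h, cov.val_apply (inv_mem hσ)]

/-- A product of `G`-conjugates of an element integral at `P` is congruent to the corresponding
power, since `P` is totally ramified. -/
theorem val_prod_sub_pow_lt {ι : Type*} (s : Finset ι) {σ : ι → F ≃ₐ[k] F}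
    (hσ : ∀ i, σ i ∈ cov.G) {u : F} (hu : cov.P.val u ≤ 1) :
    cov.P.val (∏ i ∈ s, σ i u - u ^ s.card) < 1 := by
  classical
  induction s using Finset.induction_on with
  | empty => simp
  | insert a s ha ih =>
    rw [Finset.prod_insert ha, Finset.card_insert_of_notMem ha,
      show σ a u * ∏ i ∈ s, σ i u - u ^ (s.card + 1) =
        (σ a u - u) * ∏ i ∈ s, σ i u + u * (∏ i ∈ s, σ i u - u ^ s.card) by ring]
    refine cov.P.val.map_add_lt ?_ ?_
    · rw [map_mul, map_prod]
      refine (mul_le_of_le_one_right' ?_).trans_lt ((cov.totallyRamified _ (hσ a)).2 u hu)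
      exact Finset.prod_le_one' fun i _ => (cov.val_apply (hσ i) u).trans_le hu
    · rw [map_mul]
      exact (mul_le_of_le_one_left' hu).trans_lt ih

include cov in
theorem transcendental_of_fixedField_eq {x : F} (hx : fixedField cov.G = k⟮x⟯) :
    Transcendental k x := by
  obtain ⟨y, hy, h⟩ := cov.rational
  intro hxa
  have : Algebra.IsAlgebraic k k⟮x⟯ := isAlgebraic_adjoin_simple hxa.isIntegral
  have hm : y ∈ k⟮x⟯ := hx ▸ h ▸ mem_adjoin_simple_self k y
  exact hy ((isAlgebraic_iff (x := (⟨y, hm⟩ : k⟮x⟯))).1 (Algebra.IsAlgebraic.isAlgebraic _))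

theorem finiteDimensional_adjoin {x : F} (hx : fixedField cov.G = k⟮x⟯) :
    FiniteDimensional k⟮x⟯ F :=
  have := cov.finite
  finiteDimensional_of_fixedField_le hx.le

theorem isSeparable_adjoin {x : F} (hx : fixedField cov.G = k⟮x⟯) :
    Algebra.IsSeparable k⟮x⟯ F :=
  have := cov.finite
  have := isGalois_of_fixedField_le hx.le
  inferInstance

theorem mem_adjoin_iff {x : F} (hx : fixedField cov.G = k⟮x⟯) {f : F} : f ∈ Algebra.adjoin k {x} ↔
    IsIntegral (Algebra.adjoin k {x}) f ∧ ∀ σ ∈ cov.G, σ f = f := by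
  refine ⟨fun hf => ⟨isIntegral_algebraMap (x := (⟨f, hf⟩ : Algebra.adjoin k {x})), ?_⟩, fun hf =>
    mem_adjoin_of_isIntegral (hx ▸ (mem_fixedField_iff _ _).2 hf.2) hf.1⟩
  rw [← mem_fixedField_iff, hx]
  exact algebra_adjoin_le_adjoin k {x} hf

/-! In the following, `x` is a generator of the rational function field `F ^ G` whose only pole
is `P`. -/

section Generator

variable {x : F} (hx : fixedField cov.G = k⟮x⟯) (hreg : ∀ Q : Place k F, Q ≠ cov.P → Q.val x ≤ 1)

include hx hreg

theorem one_lt_val_generator : 1 < cov.P.val x := by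
  obtain ⟨Q, hQ⟩ := exists_place_one_lt (cov.transcendental_of_fixedField_eq hx)
    (cov.finiteDimensional_adjoin hx) (cov.isSeparable_adjoin hx)
  obtain rfl : Q = cov.P := by
    by_contra h
    exact (hreg Q h).not_gt hQ
  exact hQ

/-- The functions regular outside `P` form the integral closure of `k[x]`. -/
theorem isIntegral_iff {f : F} : IsIntegral (Algebra.adjoin k {x}) f ↔
    ∀ Q : Place k F, Q ≠ cov.P → Q.val f ≤ 1 := by
  refine ⟨fun h Q hQ => Q.val_le_one_of_isIntegral (hreg Q hQ) h, fun h => ?_⟩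
  by_contra hf
  obtain ⟨Q, hQx, hQf⟩ := exists_place_of_not_isIntegral
    (cov.finiteDimensional_adjoin hx) (cov.isSeparable_adjoin hx) hf
  refine (h Q fun hQ => ?_).not_gt hQf
  exact (hQ ▸ hQx).not_gt (cov.one_lt_val_generator hx hreg)

theorem val_aeval {q : k[X]} (hq : q ≠ 0) :
    cov.P.val (aeval x q) = cov.P.val x ^ q.natDegree :=
  valuation_aeval_eq_valuation_X_pow_natDegree_of_one_lt_valuation_X x
    (cov.one_lt_val_generator hx hreg) hq

/-- The function `x` generates a rational function field whose residue field at `P` is `k`. -/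
theorem exists_val_sub_lt_of_mem_adjoin {h : F} (hm : h ∈ k⟮x⟯) (h1 : cov.P.val h ≤ 1) :
    ∃ c : k, cov.P.val (h - algebraMap k F c) < 1 := by
  have hlt := cov.one_lt_val_generator hx hreg
  obtain ⟨r, s, rfl⟩ := (mem_adjoin_simple_iff k h).1 hm
  by_cases hr : r = 0
  · exact ⟨0, by simp [hr]⟩
  by_cases hs : s = 0
  · exact ⟨0, by simp [hs]⟩
  have hs0 : 0 < cov.P.val (aeval x s) := by
    rw [cov.val_aeval hx hreg hs]
    exact pow_pos (zero_lt_one.trans hlt) _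
  have hs1 : aeval x s ≠ 0 := fun h => by simp [h] at hs0
  rw [map_div₀, div_le_one₀ hs0, cov.val_aeval hx hreg hr, cov.val_aeval hx hreg hs,
    pow_le_pow_iff_right₀ hlt] at h1
  -- The value of `r(x) / s(x)` at infinity, which is `0` if `deg r < deg s`.
  set c := r.coeff s.natDegree / s.leadingCoeff with hc
  refine ⟨c, ?_⟩
  have e : aeval x r / aeval x s - algebraMap k F c = aeval x (r - C c * s) / aeval x s := by
    rw [map_sub, map_mul, aeval_C, sub_div, mul_div_cancel_right₀ _ hs1]
  rw [e, map_div₀, div_lt_one₀ hs0]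
  by_cases h0 : r - C c * s = 0
  · simpa [h0] using hs0
  rw [cov.val_aeval hx hreg h0, cov.val_aeval hx hreg hs]
  refine pow_lt_pow_right₀ hlt ?_
  have hle : (r - C c * s).natDegree ≤ s.natDegree :=
    (natDegree_sub_le _ _).trans (max_le h1 (natDegree_C_mul_le _ _))
  refine hle.lt_of_ne fun hd => h0 ?_
  rw [← leadingCoeff_eq_zero, leadingCoeff, hd, coeff_sub, coeff_C_mul, coeff_natDegree, hc,
    div_mul_cancel₀ _ (leadingCoeff_ne_zero.2 hs), sub_self]

/-- A function regular everywhere that vanishes at `P` is zero: its norm is a polynomial in `x`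
without a pole. -/
theorem eq_zero_of_val_lt_one {m : ℕ} {g : F} (hg : g ∈ cov.L m) (h1 : cov.P.val g < 1) :
    g = 0 := by
  classical
  have := cov.finite
  have := Fintype.ofFinite cov.G
  have hN : ∏ σ : cov.G, (σ : F ≃ₐ[k] F) g ∈ Algebra.adjoin k {x} := by
    refine (cov.mem_adjoin_iff hx).2 ⟨(cov.isIntegral_iff hx hreg).2
      (cov.prod_mem_L Finset.univ fun σ _ => cov.apply_mem_L σ.2 hg).2, fun τ hτ => ?_⟩
    rw [map_prod]
    exact Fintype.prod_equiv (Equiv.mulLeft ⟨τ, hτ⟩) _ _ fun σ => rfl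
  have hv : cov.P.val (∏ σ : cov.G, (σ : F ≃ₐ[k] F) g) < 1 := by
    rw [map_prod, Finset.prod_congr rfl fun σ _ => cov.val_apply σ.2 g, Finset.prod_const]
    exact pow_lt_one₀ zero_le h1 (by simp)
  have h0 : ∏ σ : cov.G, (σ : F ≃ₐ[k] F) g = 0 := by
    rw [Algebra.adjoin_singleton_eq_range_aeval] at hN
    obtain ⟨q, hq⟩ := hN
    have hq : aeval x q = _ := hq
    by_cases hq0 : q = 0
    · rw [← hq, hq0, map_zero]
    rw [← hq, cov.val_aeval hx hreg hq0] at hv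
    exact absurd hv (one_le_pow₀ (cov.one_lt_val_generator hx hreg).le).not_gt
  obtain ⟨σ, -, hσ⟩ := Finset.prod_eq_zero_iff.1 h0
  exact (map_eq_zero_iff _ (σ : F ≃ₐ[k] F).injective).1 hσ

theorem exists_hasPole {m : ℕ} {f : F} (hf : f ∈ cov.L m) (h0 : f ≠ 0) :
    ∃ n ≤ m, cov.HasPole f n := by
  have hv : cov.P.val f ≠ 0 := (_root_.map_ne_zero _).2 h0
  have h1 : 1 ≤ cov.P.val f := not_lt.1 fun h => h0 (cov.eq_zero_of_val_lt_one hx hreg hf h)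
  have hlog := WithZero.exp_log hv
  have hn : 0 ≤ WithZero.log (cov.P.val f) := by
    rwa [← WithZero.exp_le_exp, hlog, WithZero.exp_zero]
  obtain ⟨n, hn⟩ := Int.eq_ofNat_of_zero_le hn
  have hfn : cov.P.val f = WithZero.exp (n : ℤ) := by rw [← hn, hlog]
  refine ⟨n, ?_, ⟨hfn.le, hf.2⟩, hfn⟩
  have := hf.1
  rw [hfn, WithZero.exp_le_exp] at this
  exact_mod_cast this

theorem exists_generator_hasPole : ∃ d : ℕ, 0 < d ∧ cov.HasPole x d := by
  have hlt := cov.one_lt_val_generator hx hreg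
  have hv : cov.P.val x ≠ 0 := (zero_lt_one.trans hlt).ne'
  have hlog := WithZero.exp_log hv
  have hn : 0 < WithZero.log (cov.P.val x) := by
    rwa [← WithZero.exp_lt_exp, hlog, WithZero.exp_zero]
  obtain ⟨n, hn'⟩ := Int.eq_ofNat_of_zero_le hn.le
  have hfn : cov.P.val x = WithZero.exp (n : ℤ) := by rw [← hn', hlog]
  exact ⟨n, by omega, ⟨hfn.le, hreg⟩, hfn⟩

/-- The powers of `x` provide infinitely many pole numbers. -/
theorem infinite_poleNumbers : {m | ∃ f : F, cov.HasPole f m}.Infinite := by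
  obtain ⟨d, hd, h⟩ := cov.exists_generator_hasPole hx hreg
  refine Set.infinite_of_injective_forall_mem (f := fun j : ℕ => j * d)
    (fun _ _ h => Nat.eq_of_mul_eq_mul_right hd h) fun j => ⟨x ^ j, ⟨?_, fun Q hQ => ?_⟩, ?_⟩
  · simp [h.2, ← WithZero.exp_nsmul]
  · rw [map_pow]
    exact pow_le_one' (hreg Q hQ) j
  · simp [h.2, ← WithZero.exp_nsmul]

theorem poleNumber_strictMono : StrictMono cov.poleNumber :=
  Nat.nth_strictMono (cov.infinite_poleNumbers hx hreg)

/-- There are no pole numbers between `m_c` and `m_{c+1}`. -/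
theorem mem_L_poleNumber {m c : ℕ} (hm : m < cov.poleNumber (c + 1)) {f : F} (hf : f ∈ cov.L m) :
    f ∈ cov.L (cov.poleNumber c) := by
  by_cases h0 : f = 0
  · rw [h0]
    exact zero_mem _
  obtain ⟨n, hn, h⟩ := cov.exists_hasPole hx hreg hf h0
  exact cov.L_mono (Nat.le_nth_of_lt_nth_succ (hn.trans_lt hm) ⟨f, h⟩) h.1

/-- An automorphism in `G` that fixes all functions regular outside `P` is trivial, since these
generate the function field. -/
theorem eq_one_of_forall_fixed {σ : F ≃ₐ[k] F}
    (h : ∀ c, ∀ f ∈ cov.L (cov.poleNumber c), σ f = f) : σ = 1 := by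
  have key : ∀ a : F, IsIntegral (Algebra.adjoin k {x}) a → σ a = a := by
    intro a ha
    have hreg' := (cov.isIntegral_iff hx hreg).1 ha
    by_cases h0 : a = 0
    · simp [h0]
    have hlog := WithZero.exp_log ((_root_.map_ne_zero cov.P.val).2 h0)
    let n := (WithZero.log (cov.P.val a)).toNat
    refine h n a (cov.L_mono ((cov.poleNumber_strictMono hx hreg).id_le n) ⟨?_, hreg'⟩)
    rw [← hlog, WithZero.exp_le_exp]
    exact Int.self_le_toNat _
  ext f
  obtain ⟨a, b, hb, hai, hbi, e⟩ := exists_mul_isIntegral (cov.finiteDimensional_adjoin hx) f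
  have := key a hai
  rw [← e, map_mul, key b hbi] at this
  exact mul_right_cancel₀ hb this

variable [Fact p.Prime] [IsAlgClosed k] [CharP k p]

/-- The residue field at `P` is `k`: the norm of `u` is congruent to a power of `u` with exponent
the power `|G|` of `p`, and lies in the rational function field `k(x)`. -/
theorem exists_val_sub_lt {u : F} (hu : cov.P.val u ≤ 1) :
    ∃ c : k, cov.P.val (u - algebraMap k F c) < 1 := by
  classical
  have := cov.finite
  have := Fintype.ofFinite cov.G
  have : CharP F p := charP_of_injective_algebraMap (algebraMap k F).injective p
  obtain ⟨r, hr⟩ := IsPGroup.iff_card.1 cov.isPGroup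
  have hN := cov.val_prod_sub_pow_lt Finset.univ (σ := fun σ : cov.G => (σ : F ≃ₐ[k] F))
    (fun σ => σ.2) hu
  rw [Finset.card_univ, ← Nat.card_eq_fintype_card, hr] at hN
  obtain ⟨c', hc'⟩ := cov.exists_val_sub_lt_of_mem_adjoin hx hreg
    (h := ∏ σ : cov.G, (σ : F ≃ₐ[k] F) u) (by
      rw [← hx, mem_fixedField_iff]
      intro τ hτ
      rw [map_prod]
      exact Fintype.prod_equiv (Equiv.mulLeft ⟨τ, hτ⟩) _ _ fun σ => rfl) (by
      rw [map_prod]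
      exact Finset.prod_le_one' fun σ _ => (cov.val_apply σ.2 u).trans_le hu)
  have hpos : 0 < p ^ r := pow_pos (Fact.out : p.Prime).pos r
  obtain ⟨c, rfl⟩ := IsAlgClosed.exists_pow_nat_eq c' hpos
  refine ⟨c, ?_⟩
  -- Both `u ^ |G|` and `c ^ |G|` are congruent to the norm of `u`.
  have h : cov.P.val ((u - algebraMap k F c) ^ p ^ r) < 1 := by
    rw [sub_pow_char_pow, ← map_pow]
    have := cov.P.val.map_sub_lt hc' hN
    rwa [sub_sub_sub_cancel_left] at this
  rw [map_pow] at h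
  exact (pow_lt_one_iff hpos.ne').1 h

theorem mem_range_of_mem_L_zero {f : F} (hf : f ∈ cov.L 0) : ∃ c : k, algebraMap k F c = f := by
  obtain ⟨c, hc⟩ := cov.exists_val_sub_lt hx hreg (u := f) (by simpa using hf.1)
  refine ⟨c, (sub_eq_zero.1 (cov.eq_zero_of_val_lt_one hx hreg (m := 0) ?_ hc)).symm⟩
  exact sub_mem hf (cov.algebraMap_mem_L c 0)

/-- The space `L(m P)` is spanned by `L((m - 1) P)` and any function with pole divisor `m P`. -/
theorem exists_sub_smul_mem_L {m : ℕ} (hm : 0 < m) {f g : F} (hf : f ∈ cov.L m)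
    (hg : cov.HasPole g m) : ∃ c : k, f - c • g ∈ cov.L (m - 1) := by
  have hg0 : g ≠ 0 := fun h => by simpa [h] using hg.2.symm
  have hgv : cov.P.val g ≠ 0 := (_root_.map_ne_zero _).2 hg0
  obtain ⟨c, hc⟩ := cov.exists_val_sub_lt hx hreg (u := f / g) (by
    rw [map_div₀, div_le_one₀ (zero_lt_iff.2 hgv), hg.2]
    exact hf.1)
  refine ⟨c, ?_, (sub_mem hf (Submodule.smul_mem _ c hg.1)).2⟩
  have e : f - c • g = (f / g - algebraMap k F c) * g := by
    rw [sub_mul, div_mul_cancel₀ _ hg0, Algebra.smul_def]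
  have : cov.P.val (f - c • g) < WithZero.exp (m : ℤ) := by
    rw [e, map_mul, ← hg.2]
    exact mul_lt_of_lt_one_left (zero_lt_iff.2 hgv) hc
  rw [← WithZero.lt_mul_exp_iff_le (by simp), ← WithZero.exp_add]
  convert this
  omega

end Generator

variable [Fact p.Prime] [CharP k p]

/-- The ramification at `P` is wild: `σ` acts trivially on `f / 𝔪 f`. The unit `u = σ f / f` has
norm `1` over the powers of `σ`, so `u ^ |G| ≡ 1`, and `|G|` is a power of `p`. -/
theorem val_apply_sub_lt {σ : F ≃ₐ[k] F} (hσ : σ ∈ cov.G) {f : F} (hf : f ≠ 0) :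
    cov.P.val (σ f - f) < cov.P.val f := by
  have := cov.finite
  have : CharP F p := charP_of_injective_algebraMap (algebraMap k F).injective p
  obtain ⟨r, hr⟩ := IsPGroup.iff_card.1 cov.isPGroup
  have hfv : cov.P.val f ≠ 0 := (_root_.map_ne_zero _).2 hf
  have hu : cov.P.val (σ f / f) = 1 := by rw [map_div₀, cov.val_apply hσ, div_self hfv]
  have hprod : ∀ n : ℕ, ∏ i ∈ Finset.range n, (σ ^ i) (σ f / f) = (σ ^ n) f / f := by
    intro n
    induction n with
    | zero => simp [hf]
    | succ n ih =>
      rw [Finset.prod_range_succ, ih, map_div₀, pow_succ, AlgEquiv.mul_apply,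
        mul_comm, div_mul_div_cancel₀]
      exact (_root_.map_ne_zero _).2 hf
  have h1 := cov.val_prod_sub_pow_lt (Finset.range (p ^ r)) (σ := fun i => σ ^ i)
    (fun i => pow_mem hσ i) hu.le
  have hσ1 : σ ^ p ^ r = 1 := by
    rw [← hr]
    exact congr_arg Subtype.val (pow_card_eq_one' (x := (⟨σ, hσ⟩ : cov.G)))
  rw [hprod, hσ1, AlgEquiv.one_apply, div_self hf, Finset.card_range,
    show (1 : F) = 1 ^ p ^ r by simp, ← sub_pow_char_pow, map_pow,
    pow_lt_one_iff (pow_pos (Fact.out : p.Prime).pos r).ne'] at h1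
  have e : σ f - f = -((1 - σ f / f) * f) := by
    rw [sub_mul, div_mul_cancel₀ _ hf]
    ring
  rw [e, Valuation.map_neg, map_mul]
  exact mul_lt_of_lt_one_left (zero_lt_iff.2 hfv) h1

theorem apply_sub_mem_L {σ : F ≃ₐ[k] F} (hσ : σ ∈ cov.G) {m : ℕ} (hm : 0 < m) {f : F}
    (hf : cov.HasPole f m) : σ f - f ∈ cov.L (m - 1) := by
  have hf0 : f ≠ 0 := fun h => by simpa [h] using hf.2.symm
  refine ⟨?_, (sub_mem (cov.apply_mem_L hσ hf.1) hf.1).2⟩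
  have h := cov.val_apply_sub_lt hσ hf0
  rw [hf.2] at h
  rw [← WithZero.lt_mul_exp_iff_le (by simp), ← WithZero.exp_add]
  convert h
  omega

end Cover

/-! ### Additive polynomials -/

section Additive

variable {E : Type*} [Field E]

/-- The monic additive polynomial `Y ^ (p ^ n) + ∑_{j < n} a_j Y ^ (p ^ j)`. -/
noncomputable def additivePoly (p n : ℕ) (a : ℕ → E) : E[X] :=
  X ^ p ^ n + ∑ j ∈ Finset.range n, C (a j) * X ^ p ^ j

variable (p : ℕ) [Fact p.Prime]

theorem degree_additivePoly_tail (n : ℕ) (a : ℕ → E) :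
    (∑ j ∈ Finset.range n, C (a j) * X ^ p ^ j).degree < ((p ^ n : ℕ) : WithBot ℕ) := by
  refine (degree_sum_le _ _).trans_lt ((Finset.sup_lt_iff (WithBot.bot_lt_coe _)).2 fun j hj => ?_)
  refine (degree_C_mul_X_pow_le _ _).trans_lt ?_
  exact_mod_cast Nat.pow_lt_pow_right (Fact.out : p.Prime).one_lt (Finset.mem_range.1 hj)

theorem monic_additivePoly (n : ℕ) (a : ℕ → E) : (additivePoly p n a).Monic :=
  monic_X_pow_add (degree_additivePoly_tail p n a)

theorem natDegree_additivePoly (n : ℕ) (a : ℕ → E) : (additivePoly p n a).natDegree = p ^ n := by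
  apply natDegree_eq_of_degree_eq_some
  rw [additivePoly, degree_add_eq_left_of_degree_lt, degree_X_pow]
  rw [degree_X_pow]
  exact degree_additivePoly_tail p n a

theorem coeff_additivePoly {n : ℕ} (a : ℕ → E) {j : ℕ} (hj : j < n) :
    (additivePoly p n a).coeff (p ^ j) = a j := by
  have hinj := Nat.pow_right_injective (Fact.out : p.Prime).two_le
  simp only [additivePoly, coeff_add, coeff_X_pow, finsetSum_coeff, coeff_C_mul, mul_ite, mul_one,
    mul_zero, hinj.eq_iff]
  rw [if_neg hj.ne, zero_add, Finset.sum_ite_eq, if_pos (Finset.mem_range.2 hj)]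

variable [CharP E p]

theorem eval_add_additivePoly (n : ℕ) (a : ℕ → E) (x y : E) :
    (additivePoly p n a).eval (x + y) =
      (additivePoly p n a).eval x + (additivePoly p n a).eval y := by
  simp only [additivePoly, eval_add, eval_finsetSum, eval_mul, eval_C, eval_pow, eval_X,
    add_pow_char_pow, mul_add, Finset.sum_add_distrib]
  ring

/-- The roots of `Q ^ p - c Q` for an additive polynomial `Q` form again an additive polynomial. -/
theorem exists_additivePoly_pow_sub (n : ℕ) (a : ℕ → E) (c : E) :
    ∃ b, additivePoly p n a ^ p - C c * additivePoly p n a = additivePoly p (n + 1) b := by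
  refine ⟨fun j => (if j = 0 then 0 else a (j - 1) ^ p) - c * (if j = n then 1 else a j), ?_⟩
  simp only [additivePoly]
  rw [add_pow_char, sum_pow_char, ← pow_mul, ← pow_succ]
  simp only [C_sub, C_mul, sub_mul, Finset.sum_sub_distrib]
  rw [Finset.sum_range_succ', Finset.sum_range_succ (n := n)]
  have h : ∀ j ∈ Finset.range n, C c * C (if j = n then 1 else a j) * X ^ p ^ j =
      C c * (C (a j) * X ^ p ^ j) := fun j hj => by
    rw [if_neg (Finset.mem_range.1 hj).ne, mul_assoc]
  rw [Finset.sum_congr rfl h, ← Finset.mul_sum]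
  simp only [mul_pow, ← C_pow, ← pow_mul, ← pow_succ, if_true, C_0, C_1, zero_mul,
    Nat.succ_ne_zero, if_false, Nat.add_sub_cancel]
  ring

theorem natCard_le_of_forall_eval {W : AddSubgroup E} [Finite W] {Q : E[X]} (hQ : Q ≠ 0)
    (h : ∀ w ∈ W, Q.eval w = 0) : Nat.card W ≤ Q.natDegree := by
  classical
  have hW : (W : Set E).Finite := Set.toFinite _
  rw [show Nat.card W = hW.toFinset.card from Nat.card_eq_card_finite_toFinset hW]
  refine card_le_degree_of_subset_roots fun w hw => ?_
  rw [mem_roots hQ]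
  exact h w (by simpa using hw)

theorem exists_natCard_eq_pow (W : AddSubgroup E) [Finite W] : ∃ n, Nat.card W = p ^ n := by
  refine (IsPGroup.iff_card (G := Multiplicative W)).1 fun w => ⟨1, ?_⟩
  apply Multiplicative.toAdd.injective
  ext
  change ((p ^ 1 • (Multiplicative.toAdd w : W) : W) : E) = 0
  simp

/-- A finite additive subgroup is the zero set of a monic additive polynomial of degree its order.
The polynomial is built one generator `w` at a time, from `Q` to `Q ^ p - Q(w) ^ (p - 1) Q`. -/
theorem exists_additivePoly_eval_eq_zero (W : AddSubgroup E) [hW : Finite W] :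
    ∃ n a, Nat.card W = p ^ n ∧ ∀ w ∈ W, (additivePoly p n a).eval w = 0 := by
  classical
  have hp := (Fact.out : p.Prime)
  have key : ∀ S : Finset E, (S : Set E) ⊆ W → ∃ n a,
      Nat.card (AddSubgroup.closure (S : Set E)) = p ^ n ∧
        ∀ w ∈ AddSubgroup.closure (S : Set E), (additivePoly p n a).eval w = 0 := by
    intro S
    induction S using Finset.induction_on with
    | empty =>
      intro _
      refine ⟨0, 0, by simp, fun w hw => ?_⟩
      have : w = 0 := by simpa using hw
      simp [this, additivePoly]
    | insert w S _ ih =>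
      intro hS
      have hS' : (S : Set E) ⊆ W := fun s hs => hS (by simp [Finset.mem_coe.1 hs])
      obtain ⟨n, a, hn, ha⟩ := ih hS'
      set V := AddSubgroup.closure (S : Set E) with hV
      set V' := AddSubgroup.closure ((insert w S : Finset E) : Set E) with hV'
      have hVV' : V ≤ V' := AddSubgroup.closure_mono (by simp)
      have hV'W : V' ≤ W := (AddSubgroup.closure_le _).2 hS
      have : Finite V' := Finite.of_injective _ (AddSubgroup.inclusion_injective hV'W)
      by_cases hw : w ∈ V
      · have : V' = V := by
          refine le_antisymm ((AddSubgroup.closure_le _).2 fun s hs => ?_) hVV'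
          rcases Finset.mem_insert.1 hs with rfl | hs
          · exact hw
          · exact AddSubgroup.subset_closure hs
        exact ⟨n, a, this ▸ hn, this ▸ ha⟩
      obtain ⟨b, hb⟩ := exists_additivePoly_pow_sub p n a ((additivePoly p n a).eval w ^ (p - 1))
      have hvan : ∀ v ∈ V', (additivePoly p (n + 1) b).eval v = 0 := by
        let φ : E →+ E := AddMonoidHom.mk' (fun e => (additivePoly p (n + 1) b).eval e)
          (eval_add_additivePoly p (n + 1) b)
        refine (AddSubgroup.closure_le φ.ker).2 fun s hs => ?_
        change (additivePoly p (n + 1) b).eval s = 0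
        rw [← hb]
        simp only [eval_sub, eval_pow, eval_mul, eval_C]
        rcases Finset.mem_insert.1 hs with rfl | hs
        · rw [← pow_succ, Nat.sub_add_cancel hp.one_le, sub_self]
        · rw [ha s (AddSubgroup.subset_closure hs), zero_pow hp.ne_zero, mul_zero, sub_zero]
      refine ⟨n + 1, b, ?_, hvan⟩
      -- The order of `V'` is a power of `p`, greater than `p ^ n` and at most `p ^ (n + 1)`.
      obtain ⟨m, hm⟩ := exists_natCard_eq_pow p V'
      have h1 : Nat.card V' ≤ p ^ (n + 1) := natDegree_additivePoly p (n + 1) b ▸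
        natCard_le_of_forall_eval (monic_additivePoly p (n + 1) b).ne_zero hvan
      have h2 : Nat.card V < Nat.card V' := by
        refine Set.Finite.card_lt_card (Set.toFinite (V' : Set E)) ?_
        exact (Set.ssubset_iff_of_subset hVV').2
          ⟨w, AddSubgroup.subset_closure (by simp), hw⟩
      rw [hn, hm, Nat.pow_lt_pow_iff_right hp.one_lt] at h2
      rw [hm, Nat.pow_le_pow_iff_right hp.one_lt] at h1
      rw [hm, show m = n + 1 by omega]
  have hfin : (W : Set E).Finite := Set.toFinite _
  have := key hfin.toFinset (by simp)
  simpa using this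

/-- The monic polynomial whose roots are the elements of a finite additive subgroup is
additive. -/
theorem exists_finprod_eq_additivePoly (W : AddSubgroup E) [Finite W] {n : ℕ}
    (hn : Nat.card W = p ^ n) : ∃ a, ∏ᶠ w ∈ (W : Set E), (X - C w) = additivePoly p n a := by
  classical
  obtain ⟨m, a, hm, ha⟩ := exists_additivePoly_eval_eq_zero p W
  obtain rfl : n = m := Nat.pow_right_injective (Fact.out : p.Prime).two_le (hn.symm.trans hm)
  refine ⟨a, ?_⟩
  have hfin : (W : Set E).Finite := Set.toFinite _
  have hcard : Nat.card W = hfin.toFinset.card := Nat.card_eq_card_finite_toFinset hfin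
  rw [finprod_mem_eq_finite_toFinset_prod _ hfin]
  refine (eq_of_monic_of_dvd_of_natDegree_le (monic_prod_of_monic _ _ fun w _ => monic_X_sub_C w)
    (monic_additivePoly p n a) ?_ ?_).symm
  · refine Finset.prod_dvd_of_coprime (fun x _ y _ hxy => ?_) fun w hw => ?_
    · exact isCoprime_X_sub_C_of_isUnit_sub (sub_ne_zero.2 hxy).isUnit
    · exact dvd_iff_isRoot.2 (ha w (by simpa using hw))
  · rw [natDegree_additivePoly, natDegree_prod_of_monic _ _ fun w _ => monic_X_sub_C w]
    simp [← hcard, hm]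

end Additive

/-! ### Jumps of a decreasing sequence of finite groups -/

section Jumps

variable {A : Type*} [Group A] {K : ℕ → Subgroup A}

theorem eq_of_forall_not_lt (hK : Antitone K) {a b : ℕ} (hab : a ≤ b)
    (h : ∀ i, a ≤ i → i < b → ¬ K (i + 1) < K i) : K b = K a := by
  induction b, hab using Nat.le_induction with
  | base => rfl
  | succ b hab ih =>
    rw [← ih fun i hi hib => h i hi (hib.trans b.lt_succ_self)]
    exact (eq_or_lt_of_le (hK b.le_succ)).resolve_right (h b hab b.lt_succ_self)

theorem finite_setOf_lt (hK : Antitone K) [Finite (K 0)] : {i | K (i + 1) < K i}.Finite := by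
  have hfin : ∀ i, (K i : Set A).Finite := fun i =>
    (Set.toFinite (K 0 : Set A)).subset (hK (Nat.zero_le i))
  refine Set.Finite.of_finite_image (f := fun i => Nat.card (K i))
    ((Set.finite_Iic (Nat.card (K 0))).subset ?_) ?_
  · rintro _ ⟨i, -, rfl⟩
    exact Nat.card_mono (hfin 0) (hK (Nat.zero_le i))
  · have key : ∀ i j, K (i + 1) < K i → i < j → Nat.card (K j) < Nat.card (K i) := fun i j hi hij =>
      Set.Finite.card_lt_card (hfin i) ((hK hij).trans_lt hi)
    intro i hi j hj hij
    rcases lt_trichotomy i j with h | h | h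
    · exact absurd hij (key i j hi h).ne'
    · exact h
    · exact absurd hij (key j i hj h).ne

theorem nth_mem_of_lt_ncard {q : ℕ → Prop} (hq : {i | q i}.Finite) {i : ℕ}
    (hi : i < {i | q i}.ncard) : q (Nat.nth q i) :=
  Nat.nth_mem_of_lt_card hq (by rwa [Set.ncard_eq_toFinset_card _ hq] at hi)

theorem exists_lt_ncard_nth_eq {q : ℕ → Prop} (hq : {i | q i}.Finite) {a : ℕ} (ha : q a) :
    ∃ i < {i | q i}.ncard, Nat.nth q i = a := by
  rw [Set.ncard_eq_toFinset_card _ hq]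
  exact Nat.exists_lt_card_finite_nth_eq hq ha

theorem nth_le_nth_of_lt_ncard {q : ℕ → Prop} (hq : {i | q i}.Finite) {i j : ℕ} (h : i ≤ j)
    (hj : j < {i | q i}.ncard) : Nat.nth q i ≤ Nat.nth q j :=
  Nat.nth_le_nth_of_lt_card hq h (by rwa [Set.ncard_eq_toFinset_card _ hq] at hj)

theorem nth_lt_nth_of_lt_ncard {q : ℕ → Prop} (hq : {i | q i}.Finite) {i j : ℕ} (h : i < j)
    (hj : j < {i | q i}.ncard) : Nat.nth q i < Nat.nth q j :=
  Nat.nth_lt_nth_of_lt_card hq h (by rwa [Set.ncard_eq_toFinset_card _ hq] at hj)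

end Jumps

/-! ### The representation filtration and its tower of fixed fields -/

namespace Cover

open IntermediateField

variable {p : ℕ} {k : Type v} {F : Type u} [Field k] [Field F] [Algebra k F] (cov : Cover p k F)

theorem mem_kerRho_iff {i : ℕ} {σ : F ≃ₐ[k] F} : σ ∈ cov.kerRho i ↔
    σ ∈ cov.G ∧ ∀ a ∈ cov.L (cov.poleNumber i), σ a = a := by
  rw [kerRho, Subgroup.mem_inf, _root_.mem_fixingSubgroup_iff]
  rfl

theorem kerRho_zero_finite : Finite (cov.kerRho 0) :=
  have := cov.finite
  Finite.of_injective _ (Subgroup.inclusion_injective (inf_le_left : cov.kerRho 0 ≤ cov.G))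

theorem conj_mem_kerRho {i : ℕ} {g h : F ≃ₐ[k] F} (hg : g ∈ cov.G) (hh : h ∈ cov.kerRho i) :
    g * h * g⁻¹ ∈ cov.kerRho i := by
  rw [mem_kerRho_iff] at hh ⊢
  refine ⟨mul_mem (mul_mem hg hh.1) (inv_mem hg), fun a ha => ?_⟩
  rw [AlgEquiv.mul_apply, AlgEquiv.mul_apply, hh.2 _ (cov.apply_mem_L (inv_mem hg) ha)]
  exact g.apply_symm_apply a

/-- The group with fixed field `F_i`: the kernel of `ρ_{c_i}` for `i ≤ n`, and the trivial group
for `i > n`. -/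
noncomputable def towerGroup (i : ℕ) : Subgroup (F ≃ₐ[k] F) :=
  open Classical in if i ≤ cov.numJumps then cov.kerRho (cov.jump i) else ⊥

theorem towerGroup_of_le {i : ℕ} (h : i ≤ cov.numJumps) :
    cov.towerGroup i = cov.kerRho (cov.jump i) := if_pos h

theorem towerGroup_of_lt {i : ℕ} (h : cov.numJumps < i) : cov.towerGroup i = ⊥ :=
  if_neg h.not_ge

theorem tower_eq (i : ℕ) : cov.tower i = fixedField (cov.towerGroup i) := by
  rw [tower]
  split_ifs with h
  · rw [cov.towerGroup_of_le h]
  · rw [cov.towerGroup_of_lt (not_le.1 h), fixedField_bot]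

theorem mem_tower_iff {i : ℕ} {a : F} : a ∈ cov.tower i ↔ ∀ σ ∈ cov.towerGroup i, σ a = a := by
  rw [tower_eq, mem_fixedField_iff]

theorem towerGroup_le (i : ℕ) : cov.towerGroup i ≤ cov.G := by
  rcases le_or_gt i cov.numJumps with h | h
  · rw [cov.towerGroup_of_le h]
    exact inf_le_left
  · rw [cov.towerGroup_of_lt h]
    exact bot_le

instance (i : ℕ) : Finite (cov.towerGroup i) :=
  have := cov.finite
  Finite.of_injective _ (Subgroup.inclusion_injective (cov.towerGroup_le i))

theorem conj_mem_towerGroup {i : ℕ} {g h : F ≃ₐ[k] F} (hg : g ∈ cov.G)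
    (hh : h ∈ cov.towerGroup i) : g * h * g⁻¹ ∈ cov.towerGroup i := by
  rcases le_or_gt i cov.numJumps with hi | hi
  · rw [cov.towerGroup_of_le hi] at hh ⊢
    exact cov.conj_mem_kerRho hg hh
  · rw [cov.towerGroup_of_lt hi, Subgroup.mem_bot] at hh ⊢
    simp [hh]

theorem apply_mem_tower {i : ℕ} {g : F ≃ₐ[k] F} (hg : g ∈ cov.G) {a : F} (ha : a ∈ cov.tower i) :
    g a ∈ cov.tower i := by
  rw [mem_tower_iff] at ha ⊢
  intro h hh
  have := ha _ (cov.conj_mem_towerGroup (inv_mem hg) hh)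
  rw [inv_inv, AlgEquiv.mul_apply, AlgEquiv.mul_apply] at this
  exact (AlgEquiv.symm_apply_eq g).1 this

/-- The restriction to `F_j` of an element of `G`. -/
def restrict (j : ℕ) {g : F ≃ₐ[k] F} (hg : g ∈ cov.G) : cov.tower j ≃ₐ[k] cov.tower j where
  toFun a := ⟨g a, cov.apply_mem_tower hg a.2⟩
  invFun a := ⟨g⁻¹ a, cov.apply_mem_tower (inv_mem hg) a.2⟩
  left_inv a := Subtype.ext (g.symm_apply_apply a)
  right_inv a := Subtype.ext (g.apply_symm_apply a)
  map_mul' a b := Subtype.ext (map_mul g (a : F) b)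
  map_add' a b := Subtype.ext (map_add g (a : F) b)
  commutes' c := Subtype.ext (g.commutes c)

theorem mem_gal_iff {i j : ℕ} {σ : cov.tower j ≃ₐ[k] cov.tower j} :
    σ ∈ cov.gal j i ↔ ∀ a : cov.tower j, (a : F) ∈ cov.tower i → σ a = a := by
  rw [gal, IntermediateField.mem_fixingSubgroup_iff]
  rfl

theorem restrict_mem_gal {i j : ℕ} {g : F ≃ₐ[k] F} (hg : g ∈ cov.G)
    (hgi : g ∈ cov.towerGroup i) : cov.restrict j hg ∈ cov.gal j i :=
  cov.mem_gal_iff.2 fun _ ha => Subtype.ext (cov.mem_tower_iff.1 ha g hgi)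

/-- The elements of `Gal(F_j / F_i)` are induced by elements of `Gal(F / F_i)`. -/
theorem exists_lift {i j : ℕ} (hij : cov.tower i ≤ cov.tower j)
    {σ : cov.tower j ≃ₐ[k] cov.tower j} (hσ : σ ∈ cov.gal j i) :
    ∃ g ∈ cov.towerGroup i, ∀ a : cov.tower j, g (a : F) = σ a := by
  refine exists_mem_extending (H := cov.towerGroup i) (cov.tower_eq i ▸ hij)
    ((algebraMap (cov.tower j) F).comp (σ : cov.tower j →+* cov.tower j)) fun a ha => ?_
  rw [← tower_eq] at ha
  exact congr_arg Subtype.val (cov.mem_gal_iff.1 hσ a ha)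

section Generator

variable {x : F} (hx : fixedField cov.G = k⟮x⟯) (hreg : ∀ Q : Place k F, Q ≠ cov.P → Q.val x ≤ 1)

include hx hreg

theorem kerRho_antitone : Antitone cov.kerRho := fun _ _ hij _ h => by
  rw [mem_kerRho_iff] at h ⊢
  exact ⟨h.1, fun a ha => h.2 a (cov.L_mono ((cov.poleNumber_strictMono hx hreg).monotone hij) ha)⟩

theorem finite_setOf_isJump : {i | cov.IsJump i}.Finite :=
  have := cov.kerRho_zero_finite
  finite_setOf_lt (cov.kerRho_antitone hx hreg)

/-- The kernel of `ρ_i` is trivial when there are no jumps from `i` on. -/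
theorem kerRho_eq_bot {i : ℕ} (hi : ∀ j, i ≤ j → ¬ cov.IsJump j) : cov.kerRho i = ⊥ := by
  refine (Subgroup.eq_bot_iff_forall _).2 fun σ hσ =>
    cov.eq_one_of_forall_fixed hx hreg fun c a ha => ?_
  have hK := cov.kerRho_antitone hx hreg
  -- Without jumps the kernel is constant from `i` on, so it acts trivially on all `L(m_c P)`.
  rw [← eq_of_forall_not_lt hK (le_max_left i c) fun j hj _ => hi j hj] at hσ
  exact (cov.mem_kerRho_iff.1 (hK (le_max_right i c) hσ)).2 a ha

theorem isJump_jump {i : ℕ} (h1 : 1 ≤ i) (hi : i ≤ cov.numJumps) : cov.IsJump (cov.jump i) :=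
  nth_mem_of_lt_ncard (cov.finite_setOf_isJump hx hreg) (by rw [numJumps] at hi; omega)

/-- The kernels are constant between consecutive jumps and trivial after the last one, so that
`Gal(F / F_{i+1})` is the kernel of `ρ_{c_i + 1}` for `i = n` as well. -/
theorem towerGroup_succ {i : ℕ} (h1 : 1 ≤ i) (hi : i ≤ cov.numJumps) :
    cov.towerGroup (i + 1) = cov.kerRho (cov.jump i + 1) := by
  have hfin := cov.finite_setOf_isJump hx hreg
  obtain ⟨i, rfl⟩ : ∃ j, i = j + 1 := ⟨i - 1, by omega⟩
  rcases Nat.lt_or_ge (i + 1) cov.numJumps with h | h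
  · rw [cov.towerGroup_of_le h]
    refine eq_of_forall_not_lt (cov.kerRho_antitone hx hreg)
      (nth_lt_nth_of_lt_ncard hfin (Nat.lt_succ_self i) h) fun l hl hl' hj => ?_
    have : l ≤ Nat.nth cov.IsJump i := Nat.le_nth_of_lt_nth_succ hl' hj
    change Nat.nth cov.IsJump i + 1 ≤ l at hl
    omega
  · rw [cov.towerGroup_of_lt (by omega), cov.kerRho_eq_bot hx hreg]
    intro l hl hj
    obtain ⟨m, hm, rfl⟩ := exists_lt_ncard_nth_eq hfin hj
    change m < cov.numJumps at hm
    have : Nat.nth cov.IsJump m ≤ Nat.nth cov.IsJump i :=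
      nth_le_nth_of_lt_ncard hfin (by omega) (show i < cov.numJumps by omega)
    change Nat.nth cov.IsJump i + 1 ≤ Nat.nth cov.IsJump m at hl
    omega

theorem mbar_pos (i : ℕ) : 0 < cov.mbar i :=
  (Nat.zero_le _).trans_lt (cov.poleNumber_strictMono hx hreg (Nat.lt_succ_self (cov.jump i)))

/-- The space `L((m̄_i - 1) P)` equals `L(m_{c_i} P)`, so it consists of elements of `F_i`. -/
theorem mem_tower_of_mem_L {i : ℕ} (hi : i ≤ cov.numJumps) {a : F}
    (ha : a ∈ cov.L (cov.mbar i - 1)) : a ∈ cov.tower i := by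
  refine cov.mem_tower_iff.2 fun σ hσ => ?_
  rw [cov.towerGroup_of_le hi, mem_kerRho_iff] at hσ
  refine hσ.2 a (cov.mem_L_poleNumber hx hreg ?_ ha)
  exact Nat.sub_lt (cov.mbar_pos hx hreg i) one_pos

theorem towerGroup_succ_lt {i : ℕ} (h1 : 1 ≤ i) (hi : i ≤ cov.numJumps) :
    cov.towerGroup (i + 1) < cov.towerGroup i := by
  rw [cov.towerGroup_succ hx hreg h1 hi, cov.towerGroup_of_le hi]
  exact cov.isJump_jump hx hreg h1 hi

variable [Fact p.Prime] [IsAlgClosed k] [CharP k p]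

theorem kerRho_zero : cov.kerRho 0 = cov.G := by
  refine le_antisymm inf_le_left fun σ hσ => cov.mem_kerRho_iff.2 ⟨hσ, fun a ha => ?_⟩
  rw [poleNumber_zero] at ha
  obtain ⟨c, rfl⟩ := cov.mem_range_of_mem_L_zero hx hreg ha
  exact σ.commutes c

/-- The kernels equal `G` up to the first jump; if there are no jumps then `G` is trivial. -/
theorem towerGroup_one : cov.towerGroup 1 = cov.G := by
  have hfin := cov.finite_setOf_isJump hx hreg
  rw [← cov.kerRho_zero hx hreg]
  rcases Nat.eq_zero_or_pos cov.numJumps with h | h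
  · rw [cov.towerGroup_of_lt (by omega), cov.kerRho_eq_bot hx hreg]
    intro j _ hj
    obtain ⟨m, hm, -⟩ := exists_lt_ncard_nth_eq hfin hj
    change m < cov.numJumps at hm
    omega
  · rw [cov.towerGroup_of_le h]
    refine eq_of_forall_not_lt (cov.kerRho_antitone hx hreg) (Nat.zero_le _) fun j _ hj hJ => ?_
    obtain ⟨m, hm, rfl⟩ := exists_lt_ncard_nth_eq hfin hJ
    exact hj.not_ge (nth_le_nth_of_lt_ncard hfin (Nat.zero_le m) hm)

theorem tower_one : cov.tower 1 = fixedField cov.G := by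
  rw [tower_eq, cov.towerGroup_one hx hreg]

theorem tower_one_le (i : ℕ) : cov.tower 1 ≤ cov.tower i := by
  rw [cov.tower_one hx hreg, tower_eq]
  exact fixedField_antitone (cov.towerGroup_le i)

/-- An element of `Gal(F / F_i)` fixes `F_{i+1}` as soon as it fixes `f̄_i`, since
`L(m̄_i P) = L((m̄_i - 1) P) + k f̄_i`. -/
theorem mem_towerGroup_succ_iff {i : ℕ} (h1 : 1 ≤ i) (hi : i ≤ cov.numJumps) {w : F}
    (hw : cov.HasPole w (cov.mbar i)) {σ : F ≃ₐ[k] F} :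
    σ ∈ cov.towerGroup (i + 1) ↔ σ ∈ cov.towerGroup i ∧ σ w = w := by
  rw [cov.towerGroup_succ hx hreg h1 hi]
  refine ⟨fun h => ⟨?_, (cov.mem_kerRho_iff.1 h).2 w hw.1⟩, fun h => ?_⟩
  · rw [cov.towerGroup_of_le hi]
    exact cov.kerRho_antitone hx hreg (Nat.le_succ _) h
  · refine cov.mem_kerRho_iff.2 ⟨cov.towerGroup_le i h.1, fun a ha => ?_⟩
    obtain ⟨c, hc⟩ := cov.exists_sub_smul_mem_L hx hreg (cov.mbar_pos hx hreg i) ha hw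
    have := cov.mem_tower_iff.1 (cov.mem_tower_of_mem_L hx hreg hi hc) σ h.1
    rwa [map_sub, map_smul, h.2, sub_left_inj] at this

/-- `F_{i+1} = F_i(f̄_i)`, by the Galois correspondence. -/
theorem tower_succ_eq_sup {i : ℕ} (h1 : 1 ≤ i) (hi : i ≤ cov.numJumps) {w : F}
    (hw : cov.HasPole w (cov.mbar i)) : cov.tower (i + 1) = cov.tower i ⊔ k⟮w⟯ := by
  have hG := fun σ => cov.mem_towerGroup_succ_iff hx hreg h1 hi hw (σ := σ)
  apply le_antisymm
  · intro a ha
    refine mem_of_forall_fixed (H := cov.towerGroup i)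
      (cov.tower_eq i ▸ le_sup_left) fun h hh hfix => ?_
    refine cov.mem_tower_iff.1 ha h ((hG h).2 ⟨hh, hfix w ?_⟩)
    exact (le_sup_right : k⟮w⟯ ≤ _) (mem_adjoin_simple_self k w)
  · refine sup_le ?_ (adjoin_simple_le_iff.2 (cov.mem_tower_iff.2 fun σ hσ => ((hG σ).1 hσ).2))
    rw [tower_eq, tower_eq]
    exact fixedField_antitone (cov.towerGroup_succ_lt hx hreg h1 hi).le

end Generator

end Cover

/-! ### Cocycles with values in submodules of a field -/

section Cohomology

variable {k : Type v} {E : Type u} [Field k] [Field E] [Algebra k E]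
  {Γ : Subgroup (E ≃ₐ[k] E)} {M M' : AddSubgroup E} {hM : IsStable Γ M} {hM' : IsStable Γ M'}

theorem Z1.ext_value {c c' : Z1 Γ M hM} (h : ∀ σ, c.value σ = c'.value σ) : c = c' :=
  groupCohomology.cocycles₁_ext fun σ => Subtype.ext (h σ)

variable (hM) in
/-- The cocycle `σ ↦ σ y - y`, with values in `M`; it need not be a coboundary, as `y` need not
lie in `M`. -/
noncomputable def subCocycle (y : E) (hy : ∀ σ ∈ Γ, σ y - y ∈ M) : Z1 Γ M hM :=
  ⟨fun σ => (⟨(σ : E ≃ₐ[k] E) y - y, hy σ σ.2⟩ : M),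
    (groupCohomology.mem_cocycles₁_iff (A := galRep Γ M hM) _).2 fun σ τ => Subtype.ext (by
      change (σ : E ≃ₐ[k] E) ((τ : E ≃ₐ[k] E) y) - y =
        (σ : E ≃ₐ[k] E) ((τ : E ≃ₐ[k] E) y - y) + ((σ : E ≃ₐ[k] E) y - y)
      rw [map_sub]
      ring)⟩

/-- Cohomologous cocycles with values in a trivial module are equal. -/
theorem Z1.eq_of_cls_eq (hfix : ∀ σ ∈ Γ, ∀ a ∈ M, σ a = a) {c c' : Z1 Γ M hM}
    (h : c.cls = c'.cls) : c = c' := by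
  obtain ⟨m, hm⟩ := (groupCohomology.H1π_eq_iff c c').1 h
  refine Z1.ext_value fun σ => sub_eq_zero.1 ?_
  have h1 : (σ : E ≃ₐ[k] E) ((show M from m : M) : E) - ((show M from m : M) : E) =
      c.value σ - c'.value σ := congr_arg (fun a : M => (a : E)) (congr_fun hm σ)
  rw [← h1, hfix σ σ.2 _ (show M from m).2, sub_self]

theorem polyH1_cls_eq_zero {Q : E[X]} (hQ : Induces Q Γ M M') (c : Z1 Γ M hM) {D : E}
    (hD : D ∈ M') (h : ∀ σ, Q.eval (c.value σ) = (σ : E ≃ₐ[k] E) D - D) :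
    polyH1 hM hM' hQ c.cls = 0 := by
  have h1 : polyH1 hM hM' hQ c.cls = groupCohomology.H1π (galRep Γ M' hM')
      (groupCohomology.mapCocycles₁ (MonoidHom.id Γ) (polyHom hM hM' hQ) c) :=
    congr_arg (fun φ => φ.hom c)
      (groupCohomology.H1π_comp_map (MonoidHom.id Γ) (polyHom hM hM' hQ))
  rw [h1, groupCohomology.H1π_eq_zero_iff]
  exact ⟨(⟨D, hD⟩ : M'), funext fun σ => Subtype.ext (h σ).symm⟩

end Cohomology

/-! ### Simple extensions -/

section Simple

variable {K E : Type*} [Field K] [Field E] [Algebra K E]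

/-- A monic polynomial with as many roots in the orbit of its root `y` as its degree is the
minimal polynomial of `y`. -/
theorem eq_minpoly_of_natCard_eq {N : Type*} [Finite N] (φ : N → E →ₐ[K] E) {y : E}
    (hφ : Function.Injective fun σ => φ σ y) {q : K[X]} (hq : q.Monic) (hy : aeval y q = 0)
    (hN : Nat.card N = q.natDegree) : q = minpoly K y := by
  classical
  have := Fintype.ofFinite N
  have hi : IsIntegral K y := ⟨q, hq, hy⟩
  refine eq_of_monic_of_dvd_of_natDegree_le (minpoly.monic hi) hq (minpoly.dvd K y hy) ?_
  rw [← hN, Nat.card_eq_fintype_card, ← Finset.card_univ,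
    ← Finset.card_image_of_injective _ hφ, ← natDegree_map (algebraMap K E)]
  refine card_le_degree_of_subset_roots fun z hz => ?_
  obtain ⟨σ, -, rfl⟩ := Finset.mem_image.1 hz
  rw [mem_roots (((minpoly.monic hi).map _).ne_zero), IsRoot.def, eval_map_algebraMap,
    aeval_algHom_apply, minpoly.aeval, map_zero]

theorem existsUnique_ringEquiv_of_minpoly {L : Type*} [Field L] [Algebra K L] {y : E} {z : L}
    (hy : IntermediateField.adjoin K {y} = ⊤) (hz : IntermediateField.adjoin K {z} = ⊤)
    {q : K[X]} (hq : q.Monic) (hirr : Irreducible q) (hqy : aeval y q = 0) (hqz : aeval z q = 0) :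
    ∃! ψ : E ≃+* L, ψ y = z ∧ ∀ a : K, ψ (algebraMap K E a) = algebraMap K L a := by
  have hiy : IsIntegral K y := ⟨q, hq, hqy⟩
  have hiz : IsIntegral K z := ⟨q, hq, hqz⟩
  have hy' : Algebra.adjoin K {y} = ⊤ := by
    rw [← IntermediateField.adjoin_simple_toSubalgebra_of_isAlgebraic hiy.isAlgebraic, hy,
      IntermediateField.top_toSubalgebra]
  have hz' : Algebra.adjoin K {z} = ⊤ := by
    rw [← IntermediateField.adjoin_simple_toSubalgebra_of_isAlgebraic hiz.isAlgebraic, hz,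
      IntermediateField.top_toSubalgebra]
  let py := PowerBasis.ofAdjoinEqTop hiy hy'
  let pz := PowerBasis.ofAdjoinEqTop hiz hz'
  have hm : minpoly K py.gen = minpoly K pz.gen := by
    rw [PowerBasis.ofAdjoinEqTop_gen, PowerBasis.ofAdjoinEqTop_gen,
      ← minpoly.eq_of_irreducible_of_monic hirr hqy hq,
      ← minpoly.eq_of_irreducible_of_monic hirr hqz hq]
  let ψ := py.equivOfMinpoly pz hm
  have hψ : ψ y = z := by
    have := py.equivOfMinpoly_gen pz hm
    rwa [PowerBasis.ofAdjoinEqTop_gen, PowerBasis.ofAdjoinEqTop_gen] at this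
  refine ⟨ψ, ⟨hψ, ψ.commutes⟩, fun ψ' h => ?_⟩
  let ψ'' : E →ₐ[K] L := { (ψ' : E →+* L) with commutes' := h.2 }
  have : ψ'' = ψ := AlgHom.ext_of_adjoin_eq_top hy' fun _ ha => by
    rw [Set.mem_singleton_iff.1 ha]
    exact h.1.trans hψ.symm
  ext a
  exact DFunLike.congr_fun this a

end Simple

/-! ### The polynomial with a given finite set of roots -/

section RootPoly

variable {E : Type*} [Field E]

theorem eval_finprod_X_sub_C {W : Set E} (hW : W.Finite) (e : E) :
    (∏ᶠ w ∈ W, (X - C w)).eval e = ∏ w ∈ hW.toFinset, (e - w) := by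
  rw [finprod_mem_eq_finite_toFinset_prod _ hW, eval_prod]
  simp

theorem eval_finprod_X_sub_C_eq_zero_iff {W : Set E} (hW : W.Finite) {e : E} :
    (∏ᶠ w ∈ W, (X - C w)).eval e = 0 ↔ e ∈ W := by
  rw [eval_finprod_X_sub_C hW, Finset.prod_eq_zero_iff]
  refine ⟨fun ⟨w, hw, h⟩ => ?_, fun h => ⟨e, by simpa using h, sub_self e⟩⟩
  rw [sub_eq_zero.1 h]
  simpa using hw

theorem finprod_X_sub_C_mem_lifts {R : Type*} [CommRing R] (f : R →+* E) {W : Set E}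
    (hW : W.Finite) (h : ∀ w ∈ W, w ∈ f.range) : ∏ᶠ w ∈ W, (X - C w) ∈ lifts f := by
  rw [finprod_mem_eq_finite_toFinset_prod _ hW]
  refine prod_mem fun w hw => ?_
  obtain ⟨r, hr⟩ := h w (by simpa using hw)
  rw [mem_lifts]
  exact ⟨X - C r, by rw [Polynomial.map_sub, map_X, map_C, hr]⟩

theorem coeff_finprod_X_sub_C_mem {S : Subring E} {W : Set E} (hW : W.Finite) (h : W ⊆ S)
    (n : ℕ) : (∏ᶠ w ∈ W, (X - C w)).coeff n ∈ S := by
  have h1 := (lifts_iff_coeff_lifts _).1 (finprod_X_sub_C_mem_lifts S.subtype hW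
    fun w hw => ⟨⟨w, h hw⟩, rfl⟩) n
  obtain ⟨s, hs⟩ := h1
  rw [← hs]
  exact s.2

theorem map_finprod_X_sub_C {W : Set E} (hW : W.Finite) (σ : E ≃+* E)
    (hσ : ∀ w, σ w ∈ W ↔ w ∈ W) :
    (∏ᶠ w ∈ W, (X - C w)).map (σ : E →+* E) = ∏ᶠ w ∈ W, (X - C w) := by
  rw [finprod_mem_eq_finite_toFinset_prod _ hW, Polynomial.map_prod]
  exact Finset.prod_equiv σ.toEquiv (by simp [hσ]) fun w _ => by simp

end RootPoly

/-! ### One step of the tower -/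

namespace Cover

open IntermediateField

variable {p : ℕ} {k : Type v} {F : Type u} [Field k] [Field F] [Algebra k F] (cov : Cover p k F)

theorem mem_space_iff {i m : ℕ} {a : cov.tower (i + 1)} :
    a ∈ cov.space i m ↔ (a : F) ∈ cov.tower i ∧ (a : F) ∈ cov.L m := Iff.rfl

/-- The set `W_i` of the differences `σ y - y` for `σ ∈ Gal(F_{i+1} / F_i)`. -/
def differences {i : ℕ} (y : cov.tower (i + 1)) : Set (cov.tower (i + 1)) :=
  Set.range fun σ : cov.gal (i + 1) i => (σ : cov.tower (i + 1) ≃ₐ[k] cov.tower (i + 1)) y - y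

/-- The polynomial `P_i`, with set of roots `W_i`. -/
noncomputable def stepPoly {i : ℕ} (y : cov.tower (i + 1)) : (cov.tower (i + 1))[X] :=
  ∏ᶠ a ∈ cov.differences y, (X - C a)

theorem mem_tower_of_forall_gal {i j : ℕ} {e : cov.tower j} (he : ∀ σ ∈ cov.gal j i, σ e = e) :
    (e : F) ∈ cov.tower i :=
  cov.mem_tower_iff.2 fun _ hg => congr_arg Subtype.val
    (he _ (cov.restrict_mem_gal (cov.towerGroup_le i hg) hg))

section Generator

variable {x : F} (hx : fixedField cov.G = k⟮x⟯) (hreg : ∀ Q : Place k F, Q ≠ cov.P → Q.val x ≤ 1)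
  {i : ℕ} (h1 : 1 ≤ i) (hi : i ≤ cov.numJumps)

include hx hreg

variable [Fact p.Prime] [IsAlgClosed k] [CharP k p]

theorem gal_le_gal_one (i j : ℕ) : cov.gal j i ≤ cov.gal j 1 := fun _ hσ =>
  cov.mem_gal_iff.2 fun a ha => cov.mem_gal_iff.1 hσ a (cov.tower_one_le hx hreg i ha)

theorem exists_lift_mem_G {j : ℕ} {σ : cov.tower j ≃ₐ[k] cov.tower j} (hσ : σ ∈ cov.gal j 1) :
    ∃ g ∈ cov.G, ∀ a : cov.tower j, g (a : F) = σ a := by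
  obtain ⟨g, hg, h⟩ := cov.exists_lift (cov.tower_one_le hx hreg j) hσ
  exact ⟨g, cov.towerGroup_le 1 hg, h⟩

theorem restrict_mem_gal_one {j : ℕ} {g : F ≃ₐ[k] F} (hg : g ∈ cov.G) :
    cov.restrict j hg ∈ cov.gal j 1 :=
  cov.restrict_mem_gal hg (cov.towerGroup_one hx hreg ▸ hg)

theorem apply_mem_tower_of_mem_gal {i j : ℕ} {σ : cov.tower j ≃ₐ[k] cov.tower j}
    (hσ : σ ∈ cov.gal j 1) {a : cov.tower j} (ha : (a : F) ∈ cov.tower i) :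
    (σ a : F) ∈ cov.tower i := by
  obtain ⟨g, hg, h⟩ := cov.exists_lift_mem_G hx hreg hσ
  rw [← h]
  exact cov.apply_mem_tower hg ha

theorem isStable_space (i m : ℕ) : IsStable (cov.gal (i + 1) 1) (cov.space i m) := by
  intro σ hσ a ha
  refine ⟨cov.apply_mem_tower_of_mem_gal hx hreg hσ ha.1, ?_⟩
  obtain ⟨g, hg, h⟩ := cov.exists_lift_mem_G hx hreg hσ
  rw [← h]
  exact cov.apply_mem_L hg ha.2

/-- The normal subgroup `Gal(F_{i+1} / F_i)` of `Gal(F_{i+1} / F_1)`. -/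
theorem conj_mem_gal {i j : ℕ} {σ h : cov.tower j ≃ₐ[k] cov.tower j} (hσ : σ ∈ cov.gal j 1)
    (hh : h ∈ cov.gal j i) : σ * h * σ⁻¹ ∈ cov.gal j i := by
  refine cov.mem_gal_iff.2 fun a ha => ?_
  rw [AlgEquiv.mul_apply, AlgEquiv.mul_apply, cov.mem_gal_iff.1 hh _
    (cov.apply_mem_tower_of_mem_gal hx hreg (inv_mem hσ) ha)]
  exact σ.apply_symm_apply a

theorem mem_adjoin_iff_of_mem_tower {i : ℕ} {e : cov.tower i} : (e : F) ∈ Algebra.adjoin k {x} ↔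
    IsIntegral (Algebra.adjoin k {x}) (e : F) ∧ ∀ σ ∈ cov.gal i 1, σ e = e := by
  rw [cov.mem_adjoin_iff hx]
  refine and_congr_right fun _ => ⟨fun h σ hσ => ?_, fun h g hg => ?_⟩
  · obtain ⟨g, hg, hgσ⟩ := cov.exists_lift_mem_G hx hreg hσ
    exact Subtype.ext ((hgσ e).symm.trans (h g hg))
  · exact congr_arg Subtype.val (h _ (cov.restrict_mem_gal_one hx hreg hg))

section Step

variable {y : cov.tower (i + 1)} (hy : cov.HasPole (y : F) (cov.mbar i))

include hi hy

theorem sub_mem_space {σ : cov.tower (i + 1) ≃ₐ[k] cov.tower (i + 1)}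
    (hσ : σ ∈ cov.gal (i + 1) 1) : σ y - y ∈ cov.space i (cov.mbar i - 1) := by
  obtain ⟨g, hg, h⟩ := cov.exists_lift_mem_G hx hreg hσ
  have hL : ((σ y - y : cov.tower (i + 1)) : F) ∈ cov.L (cov.mbar i - 1) := by
    have := cov.apply_sub_mem_L hg (cov.mbar_pos hx hreg i) hy
    rw [h] at this
    exact this
  exact ⟨cov.mem_tower_of_mem_L hx hreg hi hL, hL⟩

theorem apply_sub_eq {σ τ : cov.tower (i + 1) ≃ₐ[k] cov.tower (i + 1)}
    (hσ : σ ∈ cov.gal (i + 1) i) (hτ : τ ∈ cov.gal (i + 1) 1) : σ (τ y - y) = τ y - y :=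
  cov.mem_gal_iff.1 hσ _ (cov.sub_mem_space hx hreg hi hy hτ).1

/-- On `Gal(F_{i+1} / F_i)` the cocycle `σ ↦ σ y - y` is additive. -/
theorem mul_apply_sub {σ τ : cov.tower (i + 1) ≃ₐ[k] cov.tower (i + 1)}
    (hσ : σ ∈ cov.gal (i + 1) i) (hτ : τ ∈ cov.gal (i + 1) 1) :
    (σ * τ) y - y = (σ y - y) + (τ y - y) := by
  have := cov.apply_sub_eq hx hreg hi hy hσ hτ
  rw [map_sub] at this
  rw [AlgEquiv.mul_apply]
  linear_combination this

theorem apply_mem_differences {σ : cov.tower (i + 1) ≃ₐ[k] cov.tower (i + 1)}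
    (hσ : σ ∈ cov.gal (i + 1) 1) {w : cov.tower (i + 1)} (hw : w ∈ cov.differences y) :
    σ w ∈ cov.differences y := by
  obtain ⟨⟨h, hh⟩, rfl⟩ := hw
  have hc := cov.conj_mem_gal hx hreg hσ hh
  refine ⟨⟨_, hc⟩, ?_⟩
  -- `σ h σ⁻¹` fixes `σ y - y`, so it moves `y` and `σ y` by the same amount.
  have e := cov.apply_sub_eq hx hreg hi hy hc hσ
  have e' : (σ * h * σ⁻¹) (σ y) = σ (h y) := by
    rw [AlgEquiv.mul_apply, AlgEquiv.mul_apply]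
    exact congr_arg (fun a => σ (h a)) (σ.symm_apply_apply y)
  rw [map_sub, e'] at e
  rw [map_sub]
  linear_combination -e

theorem differences_mem_space {w : cov.tower (i + 1)} (hw : w ∈ cov.differences y) :
    w ∈ cov.space i (cov.mbar i - 1) := by
  obtain ⟨σ, rfl⟩ := hw
  exact cov.sub_mem_space hx hreg hi hy (cov.gal_le_gal_one hx hreg _ _ σ.2)

include h1

theorem tower_le_succ : cov.tower i ≤ cov.tower (i + 1) :=
  (cov.tower_succ_eq_sup hx hreg h1 hi hy) ▸ le_sup_left

/-- An element of `Gal(F_{i+1} / F_1)` is determined by its action on `F_i` and on `f̄_i`. -/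
theorem eq_of_agree {σ τ : cov.tower (i + 1) ≃ₐ[k] cov.tower (i + 1)}
    (ha : ∀ a : cov.tower (i + 1), (a : F) ∈ cov.tower i → σ a = τ a)
    (hyστ : σ y = τ y) : σ = τ := by
  have key : τ⁻¹ * σ ∈ cov.gal (i + 1) i := cov.mem_gal_iff.2 fun a h => by
    rw [AlgEquiv.mul_apply, ha a h]
    exact τ.symm_apply_apply a
  obtain ⟨g, hg, h⟩ := cov.exists_lift (cov.tower_le_succ hx hreg h1 hi hy) key
  have hgy : g (y : F) = y := by
    rw [h, AlgEquiv.mul_apply, hyστ]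
    exact congr_arg Subtype.val (τ.symm_apply_apply y)
  have hg' := (cov.mem_towerGroup_succ_iff hx hreg h1 hi hy).2 ⟨hg, hgy⟩
  have : τ⁻¹ * σ = 1 := by
    ext a
    rw [← h]
    exact cov.mem_tower_iff.1 a.2 g hg'
  exact (inv_mul_eq_one.1 this).symm

theorem sub_injOn {σ τ : cov.tower (i + 1) ≃ₐ[k] cov.tower (i + 1)} (hσ : σ ∈ cov.gal (i + 1) i)
    (hτ : τ ∈ cov.gal (i + 1) i) (h : σ y - y = τ y - y) : σ = τ :=
  cov.eq_of_agree hx hreg h1 hi hy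
    (fun a ha => (cov.mem_gal_iff.1 hσ a ha).trans (cov.mem_gal_iff.1 hτ a ha).symm)
    (sub_left_injective h)

theorem finite_gal : Finite (cov.gal (i + 1) i) := by
  choose g hg h using fun σ : cov.gal (i + 1) i =>
    cov.exists_lift (cov.tower_le_succ hx hreg h1 hi hy) σ.2
  refine Finite.of_injective (fun σ => (⟨g σ, hg σ⟩ : cov.towerGroup i)) fun σ τ hστ => ?_
  have e : g σ = g τ := congr_arg Subtype.val hστ
  ext a
  rw [← h, ← h, e]

theorem finite_differences : (cov.differences y).Finite :=
  have := cov.finite_gal hx hreg h1 hi hy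
  Set.finite_range _

/-- The set `W_i` is a subgroup, isomorphic to `Gal(F_{i+1} / F_i)`. -/
theorem exists_addSubgroup_eq_differences : ∃ W : AddSubgroup (cov.tower (i + 1)),
    (W : Set (cov.tower (i + 1))) = cov.differences y ∧
      Nat.card W = Nat.card (cov.gal (i + 1) i) := by
  have hN := cov.gal_le_gal_one hx hreg i (i + 1)
  let φ : Additive (cov.gal (i + 1) i) →+ cov.tower (i + 1) :=
    AddMonoidHom.mk' (fun σ => (σ.toMul : cov.tower (i + 1) ≃ₐ[k] cov.tower (i + 1)) y - y)
      fun σ τ => cov.mul_apply_sub hx hreg hi hy σ.toMul.2 (hN τ.toMul.2)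
  refine ⟨φ.range, rfl, (Nat.card_congr (Equiv.ofInjective φ fun σ τ h => ?_)).symm⟩
  exact Subtype.ext (cov.sub_injOn hx hreg h1 hi hy σ.toMul.2 τ.toMul.2 h)

theorem exists_natCard_gal : ∃ n, 1 ≤ n ∧ Nat.card (cov.gal (i + 1) i) = p ^ n := by
  have := cov.finite_gal hx hreg h1 hi hy
  have : CharP (cov.tower (i + 1)) p :=
    charP_of_injective_algebraMap (algebraMap k (cov.tower (i + 1))).injective p
  obtain ⟨W, hW, hc⟩ := cov.exists_addSubgroup_eq_differences hx hreg h1 hi hy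
  have hfin : Finite W := by
    have := cov.finite_differences hx hreg h1 hi hy
    rw [← hW] at this
    exact this
  obtain ⟨n, hn⟩ := exists_natCard_eq_pow p W
  refine ⟨n, Nat.one_le_iff_ne_zero.2 ?_, hc ▸ hn⟩
  -- As `c_i` is a jump, some element of `Gal(F / F_i)` moves `y`.
  rintro rfl
  obtain ⟨g, hg, hg'⟩ := SetLike.exists_of_lt (cov.towerGroup_succ_lt hx hreg h1 hi)
  have hsub : Subsingleton (cov.gal (i + 1) i) :=
    (Nat.card_eq_one_iff_unique.1 (by rw [← hc, hn, pow_zero])).1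
  have hr := cov.restrict_mem_gal (j := i + 1) (cov.towerGroup_le i hg) hg
  have h0 := congr_arg Subtype.val (Subsingleton.elim (⟨_, hr⟩ : cov.gal (i + 1) i) 1)
  refine hg' ((cov.mem_towerGroup_succ_iff hx hreg h1 hi hy).2 ⟨hg, ?_⟩)
  exact congr_arg Subtype.val (DFunLike.congr_fun h0 y)

theorem pow_eq_one_of_mem_gal {σ : cov.tower (i + 1) ≃ₐ[k] cov.tower (i + 1)}
    (hσ : σ ∈ cov.gal (i + 1) i) : σ ^ p = 1 := by
  have : CharP (cov.tower (i + 1)) p :=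
    charP_of_injective_algebraMap (algebraMap k (cov.tower (i + 1))).injective p
  have hpow : ∀ n : ℕ, (σ ^ n) y - y = n * (σ y - y) := by
    intro n
    induction n with
    | zero => simp
    | succ n ih =>
      rw [pow_succ, cov.mul_apply_sub hx hreg hi hy (pow_mem hσ n)
        (cov.gal_le_gal_one hx hreg _ _ hσ), ih]
      push_cast
      ring
  refine cov.sub_injOn hx hreg h1 hi hy (pow_mem hσ p) (one_mem _) ?_
  rw [hpow, CharP.cast_eq_zero, zero_mul, AlgEquiv.one_apply, sub_self]

theorem mul_comm_of_mem_gal {σ τ : cov.tower (i + 1) ≃ₐ[k] cov.tower (i + 1)}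
    (hσ : σ ∈ cov.gal (i + 1) i) (hτ : τ ∈ cov.gal (i + 1) i) : σ * τ = τ * σ := by
  have hN := cov.gal_le_gal_one hx hreg i (i + 1)
  refine cov.sub_injOn hx hreg h1 hi hy (mul_mem hσ hτ) (mul_mem hτ hσ) ?_
  rw [cov.mul_apply_sub hx hreg hi hy hσ (hN hτ), cov.mul_apply_sub hx hreg hi hy hτ (hN hσ)]
  exact add_comm _ _

theorem map_stepPoly {σ : cov.tower (i + 1) ≃ₐ[k] cov.tower (i + 1)}
    (hσ : σ ∈ cov.gal (i + 1) 1) :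
    (cov.stepPoly y).map (σ : cov.tower (i + 1) →+* cov.tower (i + 1)) = cov.stepPoly y := by
  refine map_finprod_X_sub_C (cov.finite_differences hx hreg h1 hi hy) (σ : _ ≃+* _) fun w =>
    ⟨fun h => ?_, cov.apply_mem_differences hx hreg hi hy hσ⟩
  have := cov.apply_mem_differences hx hreg hi hy (inv_mem hσ) h
  rwa [show σ⁻¹ ((σ : _ ≃+* _) w) = w from σ.symm_apply_apply w] at this

theorem eval_stepPoly_apply {σ : cov.tower (i + 1) ≃ₐ[k] cov.tower (i + 1)}
    (hσ : σ ∈ cov.gal (i + 1) 1) (a : cov.tower (i + 1)) :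
    (cov.stepPoly y).eval (σ a) = σ ((cov.stepPoly y).eval a) := by
  conv_lhs => rw [← cov.map_stepPoly hx hreg h1 hi hy hσ]
  rw [eval_map]
  exact eval₂_hom _ a

theorem eval_stepPoly_eq_zero_iff {e : cov.tower (i + 1)} :
    (cov.stepPoly y).eval e = 0 ↔ e ∈ cov.differences y :=
  eval_finprod_X_sub_C_eq_zero_iff (cov.finite_differences hx hreg h1 hi hy)

theorem exists_stepPoly_eq {n : ℕ} (hn : Nat.card (cov.gal (i + 1) i) = p ^ n) :
    ∃ a, cov.stepPoly y = additivePoly p n a := by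
  have : CharP (cov.tower (i + 1)) p :=
    charP_of_injective_algebraMap (algebraMap k (cov.tower (i + 1))).injective p
  obtain ⟨W, hW, hc⟩ := cov.exists_addSubgroup_eq_differences hx hreg h1 hi hy
  have hfin : Finite W := by
    have := cov.finite_differences hx hreg h1 hi hy
    rw [← hW] at this
    exact this
  rw [stepPoly, ← hW]
  exact exists_finprod_eq_additivePoly p W (hc.trans hn)

theorem eval_stepPoly_add (a b : cov.tower (i + 1)) : (cov.stepPoly y).eval (a + b) =
    (cov.stepPoly y).eval a + (cov.stepPoly y).eval b := by
  have : CharP (cov.tower (i + 1)) p :=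
    charP_of_injective_algebraMap (algebraMap k (cov.tower (i + 1))).injective p
  obtain ⟨n, -, hn⟩ := cov.exists_natCard_gal hx hreg h1 hi hy
  obtain ⟨c, hc⟩ := cov.exists_stepPoly_eq hx hreg h1 hi hy hn
  rw [hc, eval_add_additivePoly]

theorem eval_stepPoly_sub (a b : cov.tower (i + 1)) : (cov.stepPoly y).eval (a - b) =
    (cov.stepPoly y).eval a - (cov.stepPoly y).eval b := by
  rw [eq_sub_iff_add_eq, ← cov.eval_stepPoly_add hx hreg h1 hi hy, sub_add_cancel]

theorem eval_stepPoly_mem_L {n : ℕ} (hn : Nat.card (cov.gal (i + 1) i) = p ^ n)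
    {e : cov.tower (i + 1)} (he : (e : F) ∈ cov.L (cov.mbar i)) :
    (((cov.stepPoly y).eval e : cov.tower (i + 1)) : F) ∈ cov.L (p ^ n * cov.mbar i) := by
  have hfin := cov.finite_differences hx hreg h1 hi hy
  obtain ⟨W, hW, hc⟩ := cov.exists_addSubgroup_eq_differences hx hreg h1 hi hy
  have hcard : hfin.toFinset.card = p ^ n := by
    rw [← hn, ← hc, ← Nat.card_eq_card_finite_toFinset hfin, ← hW]
    rfl
  rw [stepPoly, eval_finprod_X_sub_C hfin,
    show ((∏ w ∈ hfin.toFinset, (e - w) : cov.tower (i + 1)) : F) =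
      ∏ w ∈ hfin.toFinset, ((e - w : cov.tower (i + 1)) : F) from
      map_prod (algebraMap (cov.tower (i + 1)) F) _ _, ← hcard]
  refine cov.prod_mem_L _ fun w hw => sub_mem he ?_
  exact cov.L_mono (Nat.sub_le _ _)
    (cov.differences_mem_space hx hreg hi hy (by simpa using hw)).2

/-- The function `D_i = P_i(f̄_i)` expresses `P_i(C̄_i)` as a coboundary. -/
theorem eval_stepPoly_apply_sub {σ : cov.tower (i + 1) ≃ₐ[k] cov.tower (i + 1)}
    (hσ : σ ∈ cov.gal (i + 1) 1) : (cov.stepPoly y).eval (σ y - y) =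
      σ ((cov.stepPoly y).eval y) - (cov.stepPoly y).eval y := by
  rw [cov.eval_stepPoly_sub hx hreg h1 hi hy, cov.eval_stepPoly_apply hx hreg h1 hi hy hσ]

theorem eval_stepPoly_self_mem_tower :
    (((cov.stepPoly y).eval y : cov.tower (i + 1)) : F) ∈ cov.tower i := by
  refine cov.mem_tower_of_forall_gal fun σ hσ => sub_eq_zero.1 ?_
  rw [← cov.eval_stepPoly_apply_sub hx hreg h1 hi hy (cov.gal_le_gal_one hx hreg _ _ hσ)]
  exact (cov.eval_stepPoly_eq_zero_iff hx hreg h1 hi hy).2 ⟨⟨σ, hσ⟩, rfl⟩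

theorem eval_stepPoly_mem_tower {a : cov.tower (i + 1)} (ha : (a : F) ∈ cov.tower i) :
    (((cov.stepPoly y).eval a : cov.tower (i + 1)) : F) ∈ cov.tower i := by
  refine cov.mem_tower_of_forall_gal fun σ hσ => ?_
  rw [← cov.eval_stepPoly_apply hx hreg h1 hi hy (cov.gal_le_gal_one hx hreg _ _ hσ),
    cov.mem_gal_iff.1 hσ a ha]

theorem induces_stepPoly {n : ℕ} (hn : Nat.card (cov.gal (i + 1) i) = p ^ n) :
    Induces (cov.stepPoly y) (cov.gal (i + 1) 1) (cov.space i (cov.mbar i - 1))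
      (cov.space i (p ^ n * cov.mbar i)) where
  additive := cov.eval_stepPoly_add hx hreg h1 hi hy
  equivariant _ hσ := cov.eval_stepPoly_apply hx hreg h1 hi hy hσ
  mapsTo _ ha := ⟨cov.eval_stepPoly_mem_tower hx hreg h1 hi hy ha.1,
    cov.eval_stepPoly_mem_L hx hreg h1 hi hy hn (cov.L_mono (Nat.sub_le _ _) ha.2)⟩

/-- The coefficients of `P_i` are polynomials in `x`: they are regular outside `P`, and invariant
because `G` permutes `W_i`. -/
theorem coeff_stepPoly_mem_adjoin (j : ℕ) :
    (((cov.stepPoly y).coeff j : cov.tower (i + 1)) : F) ∈ Algebra.adjoin k {x} := by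
  refine (cov.mem_adjoin_iff_of_mem_tower hx hreg).2 ⟨?_, fun σ hσ => ?_⟩
  · refine coeff_finprod_X_sub_C_mem (cov.finite_differences hx hreg h1 hi hy)
      (S := (integralClosure (Algebra.adjoin k {x}) F).toSubring.comap
        (algebraMap (cov.tower (i + 1)) F)) (fun w hw => ?_) j
    exact (cov.isIntegral_iff hx hreg).2 (cov.differences_mem_space hx hreg hi hy hw).2.2
  · conv_rhs => rw [← cov.map_stepPoly hx hreg h1 hi hy hσ]
    rw [coeff_map]
    rfl

/-- The solutions `D` of `P_i(C̄_i(σ)) = σ(D) - D` differ by polynomials in `x`. -/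
theorem forall_eval_eq_iff {m : ℕ} {D : cov.tower (i + 1)} (hD : (D : F) ∈ cov.L m)
    (hP : (((cov.stepPoly y).eval y : cov.tower (i + 1)) : F) ∈ cov.L m) :
    (∀ σ ∈ cov.gal (i + 1) 1, (cov.stepPoly y).eval (σ y - y) = σ D - D) ↔
      ((D - (cov.stepPoly y).eval y : cov.tower (i + 1)) : F) ∈ Algebra.adjoin k {x} := by
  have hint : IsIntegral (Algebra.adjoin k {x})
      ((D - (cov.stepPoly y).eval y : cov.tower (i + 1)) : F) :=
    (cov.isIntegral_iff hx hreg).2 (sub_mem hD hP).2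
  rw [cov.mem_adjoin_iff_of_mem_tower hx hreg, and_iff_right hint]
  refine forall₂_congr fun σ hσ => ?_
  rw [cov.eval_stepPoly_apply_sub hx hreg h1 hi hy hσ, map_sub]
  constructor <;> intro h <;> linear_combination -h

end Step

end Generator

end Cover

/-! ### The extension `F_{i+1} / F_i` as the splitting field of `P_i(Y) - D_i` -/

namespace Cover

open IntermediateField

variable {p : ℕ} {k : Type v} {F : Type u} [Field k] [Field F] [Algebra k F] (cov : Cover p k F)
  [Fact p.Prime] [IsAlgClosed k] [CharP k p]
  {x : F} (hx : fixedField cov.G = k⟮x⟯) (hreg : ∀ Q : Place k F, Q ≠ cov.P → Q.val x ≤ 1)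
  {i : ℕ} (h1 : 1 ≤ i) (hi : i ≤ cov.numJumps)
  {y : cov.tower (i + 1)} (hy : cov.HasPole (y : F) (cov.mbar i))

include hx hreg h1 hi hy

theorem adjoin_eq_top (hle : cov.tower i ≤ cov.tower (i + 1)) :
    letI := (inclusion hle : cov.tower i →+* cov.tower (i + 1)).toAlgebra
    IntermediateField.adjoin (cov.tower i) {y} = ⊤ := by
  let := (inclusion hle : cov.tower i →+* cov.tower (i + 1)).toAlgebra
  have : IsScalarTower k (cov.tower i) (cov.tower (i + 1)) := .of_algebraMap_eq fun _ => rfl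
  let T := (IntermediateField.adjoin (cov.tower i) {y}).restrictScalars k
  have hT : cov.tower (i + 1) ≤ lift T := by
    refine (cov.tower_succ_eq_sup hx hreg h1 hi hy).trans_le ?_
    rw [sup_le_iff, adjoin_simple_le_iff]
    refine ⟨fun a ha => ?_, (mem_lift y).2 (mem_adjoin_simple_self _ y)⟩
    exact (mem_lift (⟨a, hle ha⟩ : cov.tower (i + 1))).2
      ((IntermediateField.adjoin (cov.tower i) {y}).algebraMap_mem ⟨a, ha⟩)
  exact eq_top_iff.2 fun a _ => (mem_lift a).1 (hT a.2)

/-- The polynomial `P_i(Y) - D_i` is defined and irreducible over `F_i`, being the minimal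
polynomial of `f̄_i`; hence it determines `F_{i+1} / F_i`. -/
theorem exists_polynomial (hle : cov.tower i ≤ cov.tower (i + 1)) :
    ∃ (Q : (cov.tower i)[X]) (d : cov.tower i),
      Q.map (inclusion hle : cov.tower i →+* cov.tower (i + 1)) = cov.stepPoly y ∧
      inclusion hle d = (cov.stepPoly y).eval y ∧ Irreducible (Q - C d) ∧
      ∀ (K : Type u) [Field K] [Algebra (cov.tower i) K] (z : K),
        IntermediateField.adjoin (cov.tower i) {z} = ⊤ →
        aeval z Q = algebraMap (cov.tower i) K d →
        ∃! ψ : cov.tower (i + 1) ≃+* K, ψ y = z ∧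
          ∀ a : cov.tower i, ψ (inclusion hle a) = algebraMap (cov.tower i) K a := by
  let := (inclusion hle : cov.tower i →+* cov.tower (i + 1)).toAlgebra
  obtain ⟨n, -, hn⟩ := cov.exists_natCard_gal hx hreg h1 hi hy
  obtain ⟨a, ha⟩ := cov.exists_stepPoly_eq hx hreg h1 hi hy hn
  obtain ⟨Q, hQ⟩ := (mem_lifts _).1 (finprod_X_sub_C_mem_lifts
    (inclusion hle : cov.tower i →+* cov.tower (i + 1))
    (cov.finite_differences hx hreg h1 hi hy)
    fun w hw => ⟨⟨w, (cov.differences_mem_space hx hreg hi hy hw).1⟩, rfl⟩)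
  change Q.map _ = cov.stepPoly y at hQ
  let d : cov.tower i := ⟨_, cov.eval_stepPoly_self_mem_tower hx hreg h1 hi hy⟩
  have hd : inclusion hle d = (cov.stepPoly y).eval y := rfl
  have hinj := (inclusion hle : cov.tower i →+* cov.tower (i + 1)).injective
  have hQm : Q.Monic := monic_of_injective hinj (by rw [hQ, ha]; exact monic_additivePoly p n a)
  have hQn : Q.natDegree = p ^ n := by
    rw [← natDegree_map_eq_of_injective hinj, hQ, ha, natDegree_additivePoly]
  have hdeg : (C d).degree < Q.degree := by
    refine degree_C_le.trans_lt ?_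
    rw [← natDegree_pos_iff_degree_pos, hQn]
    exact pow_pos (Fact.out : p.Prime).pos n
  have hm : (Q - C d).Monic := hQm.sub_of_left hdeg
  have haev : aeval y Q = (cov.stepPoly y).eval y := by
    rw [← hQ, eval_map]
    rfl
  have hroot : aeval y (Q - C d) = 0 := by
    rw [map_sub, aeval_C, haev, ← hd]
    exact sub_self _
  have := cov.finite_gal hx hreg h1 hi hy
  have hmin : Q - C d = minpoly (cov.tower i) y := by
    refine eq_minpoly_of_natCard_eq (N := cov.gal (i + 1) i)
      -- The automorphisms over `k` that fix `F_i` pointwise, regarded as `F_i`-linear maps.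
      (fun σ => { ((σ : cov.tower (i + 1) ≃ₐ[k] cov.tower (i + 1)) : _ →+* _) with
        commutes' := fun b => cov.mem_gal_iff.1 σ.2 _ b.2 })
      (fun σ τ h => Subtype.ext
        (cov.sub_injOn hx hreg h1 hi hy σ.2 τ.2 (congr_arg (fun b => b - y) h))) hm hroot ?_
    rw [hn, natDegree_sub_C, hQn]
  have hirr : Irreducible (Q - C d) := hmin ▸ minpoly.irreducible ⟨_, hm, hroot⟩
  refine ⟨Q, d, hQ, hd, hirr, fun K _ _ z hz hzd => ?_⟩
  refine existsUnique_ringEquiv_of_minpoly (cov.adjoin_eq_top hx hreg h1 hi hy hle) hz hm hirr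
    hroot ?_
  rw [map_sub, aeval_C, hzd, sub_self]

omit h1 hi hy in
theorem exists_restriction (hle : cov.tower i ≤ cov.tower (i + 1))
    {σ : cov.tower (i + 1) ≃ₐ[k] cov.tower (i + 1)} (hσ : σ ∈ cov.gal (i + 1) 1) :
    ∃ τ ∈ cov.gal i 1, ∀ a : cov.tower i, σ (inclusion hle a) = inclusion hle (τ a) := by
  obtain ⟨g, hg, h⟩ := cov.exists_lift_mem_G hx hreg hσ
  exact ⟨_, cov.restrict_mem_gal_one hx hreg hg, fun a => Subtype.ext (h (inclusion hle a)).symm⟩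

/-- An element `τ` of `Gal(F_i / F_1)` has exactly one extension to `F_{i+1}` for each solution `e`
of `P_i(e) = τ(D_i) - D_i`: two extensions differ by an element of `Gal(F_{i+1} / F_i)`, and two
solutions by an element of `W_i`. -/
theorem existsUnique_extension (hle : cov.tower i ≤ cov.tower (i + 1))
    {τ : cov.tower i ≃ₐ[k] cov.tower i} (hτ : τ ∈ cov.gal i 1) {d e : cov.tower i}
    (hd : inclusion hle d = (cov.stepPoly y).eval y)
    (he : (cov.stepPoly y).eval (inclusion hle e) = inclusion hle (τ d - d)) :
    ∃! σ : cov.gal (i + 1) 1,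
      (∀ a : cov.tower i, (σ : cov.tower (i + 1) ≃ₐ[k] cov.tower (i + 1)) (inclusion hle a) =
        inclusion hle (τ a)) ∧
      (σ : cov.tower (i + 1) ≃ₐ[k] cov.tower (i + 1)) y - y = inclusion hle e := by
  obtain ⟨g, hg, h⟩ := cov.exists_lift_mem_G hx hreg hτ
  set σ₀ := cov.restrict (i + 1) hg with hσ₀
  have hσ₀Γ : σ₀ ∈ cov.gal (i + 1) 1 := cov.restrict_mem_gal_one hx hreg hg
  have hσ₀τ : ∀ a : cov.tower i, σ₀ (inclusion hle a) = inclusion hle (τ a) := fun a =>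
    Subtype.ext (h a)
  have hroot : inclusion hle e - (σ₀ y - y) ∈ cov.differences y := by
    rw [← cov.eval_stepPoly_eq_zero_iff hx hreg h1 hi hy, cov.eval_stepPoly_sub hx hreg h1 hi hy,
      cov.eval_stepPoly_apply_sub hx hreg h1 hi hy hσ₀Γ, he, ← hd, hσ₀τ, map_sub, sub_self]
  obtain ⟨⟨ρ, hρ⟩, hρe⟩ := hroot
  have hρe : ρ y - y = inclusion hle e - (σ₀ y - y) := hρe
  refine ⟨⟨ρ * σ₀, mul_mem (cov.gal_le_gal_one hx hreg _ _ hρ) hσ₀Γ⟩, ⟨fun a => ?_, ?_⟩, ?_⟩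
  · change ρ (σ₀ (inclusion hle a)) = _
    rw [hσ₀τ]
    exact cov.mem_gal_iff.1 hρ _ (τ a).2
  · change (ρ * σ₀) y - y = _
    rw [cov.mul_apply_sub hx hreg hi hy hρ hσ₀Γ, hρe, sub_add_cancel]
  · rintro σ ⟨hστ, hσe⟩
    refine Subtype.ext (cov.eq_of_agree hx hreg h1 hi hy (fun a ha => ?_) ?_)
    · refine (hστ ⟨a, ha⟩).trans ?_
      change _ = ρ (σ₀ (inclusion hle ⟨a, ha⟩))
      rw [hσ₀τ]
      exact (cov.mem_gal_iff.1 hρ _ (τ ⟨a, ha⟩).2).symm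
    · have := cov.mul_apply_sub hx hreg hi hy hρ hσ₀Γ
      rw [hρe, sub_add_cancel, ← hσe] at this
      exact (sub_left_injective this).symm

end Cover
end HKG

theorem mainTheorem5 {p : ℕ} [Fact p.Prime] (hp : 5 ≤ p)
    {k : Type v} [Field k] [IsAlgClosed k] [CharP k p]
    {F : Type u} [Field F] [Algebra k F] (cov : HKG.Cover p k F)
    (f : ℕ → F) (hf : cov.IsGeneratorSystem f) :
    -- the tower starts at the rational function field and ends at `F`
    cov.tower 1 = IntermediateField.fixedField cov.G ∧
    cov.tower 1 = IntermediateField.adjoin k {f 0} ∧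
    cov.tower (cov.numJumps + 1) = ⊤ ∧
    ∀ i, 1 ≤ i → i ≤ cov.numJumps →
      -- `y` is `f̄_i`, as an element of `F_{i+1}`
      ∃ (y : cov.tower (i + 1)) (hle : cov.tower i ≤ cov.tower (i + 1)) (n : ℕ),
        (y : F) = f i ∧ 1 ≤ n ∧
        -- `F_{i+1} = F_i(f̄_i)` is elementary abelian of degree `p ^ n` over `F_i`
        cov.tower (i + 1) = cov.tower i ⊔ IntermediateField.adjoin k {f i} ∧
        Nat.card (cov.gal (i + 1) i) = p ^ n ∧
        (∀ σ ∈ cov.gal (i + 1) i, σ ^ p = 1 ∧ ∀ τ ∈ cov.gal (i + 1) i, σ * τ = τ * σ) ∧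
        cov.gal (i + 1) i ≤ cov.gal (i + 1) 1 ∧
        -- `c` is the cocycle `C̄_i` on `Gal(F_{i+1}/F_1)`, extending `c₀` on `Gal(F_{i+1}/F_i)`
        ∃ (hM : HKG.IsStable (cov.gal (i + 1) 1) (cov.space i (cov.mbar i - 1)))
          (hM' : HKG.IsStable (cov.gal (i + 1) 1) (cov.space i (p ^ n * cov.mbar i)))
          (hM₀ : HKG.IsStable (cov.gal (i + 1) i) (cov.space i (cov.mbar i - 1)))
          (c : HKG.Z1 (cov.gal (i + 1) 1) (cov.space i (cov.mbar i - 1)) hM)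
          (c₀ : HKG.Z1 (cov.gal (i + 1) i) (cov.space i (cov.mbar i - 1)) hM₀),
          (∀ a : F, a ∈ cov.L (cov.mbar i - 1) → a ∈ cov.tower i) ∧
          (∀ σ, c.value σ = (σ : cov.tower (i + 1) ≃ₐ[k] cov.tower (i + 1)) y - y) ∧
          (∀ σ, c₀.value σ = (σ : cov.tower (i + 1) ≃ₐ[k] cov.tower (i + 1)) y - y) ∧
          -- `c₀` is an injective homomorphism, determined by its class
          Function.Injective c₀.value ∧
          (∀ σ τ, c₀.value (σ * τ) = c₀.value σ + c₀.value τ) ∧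
          (∀ c₁ : HKG.Z1 (cov.gal (i + 1) i) (cov.space i (cov.mbar i - 1)) hM₀,
            c₁.cls = c₀.cls → c₁ = c₀) ∧
          -- the polynomial `P_i` defined by `c₀` is additive
          (∃ a : ℕ → cov.tower (i + 1),
            HKG.valuePoly c₀ = X ^ p ^ n + ∑ j ∈ Finset.range n, C (a j) * X ^ p ^ j ∧
            (∀ j < n, (a j : F) ∈ Algebra.adjoin k {f 0}) ∧
            ((∀ σ, c₀.value σ ∈ (algebraMap k (cov.tower (i + 1))).range) →
              ∀ j < n, a j ∈ (algebraMap k (cov.tower (i + 1))).range)) ∧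
          -- the class of `C̄_i` is in the kernel of the map `P_i` on cohomology
          (∃ hP : HKG.Induces (HKG.valuePoly c₀) (cov.gal (i + 1) 1)
              (cov.space i (cov.mbar i - 1)) (cov.space i (p ^ n * cov.mbar i)),
            HKG.polyH1 hM hM' hP c.cls = 0) ∧
          -- `D_i = P_i(f̄_i)` expresses `P_i(C̄_i)` as a coboundary; it is unique up to `k[f̄_0]`
          (HKG.valuePoly c₀).eval y ∈ cov.space i (p ^ n * cov.mbar i) ∧
          (∀ D ∈ cov.space i (p ^ n * cov.mbar i),
            (∀ σ, (HKG.valuePoly c₀).eval (c.value σ) =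
              (σ : cov.tower (i + 1) ≃ₐ[k] cov.tower (i + 1)) D - D) ↔
            ((D - (HKG.valuePoly c₀).eval y : cov.tower (i + 1)) : F) ∈
              Algebra.adjoin k {f 0}) ∧
          -- `F_{i+1} / F_i`, with the action of `Gal(F_{i+1}/F_1)`, is determined by
          -- the additive polynomial, `D_i` and the cocycle: `Q = P_i`, `d = D_i` over `F_i`
          ∃ (Q : (cov.tower i)[X]) (d : cov.tower i),
            Q.map (IntermediateField.inclusion hle : cov.tower i →+* cov.tower (i + 1)) =
              HKG.valuePoly c₀ ∧
            IntermediateField.inclusion hle d = (HKG.valuePoly c₀).eval y ∧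
            Irreducible (Q - C d) ∧
            (∀ (K : Type u) [Field K] [Algebra (cov.tower i) K] (z : K),
              IntermediateField.adjoin (cov.tower i) {z} = ⊤ →
              aeval z Q = algebraMap (cov.tower i) K d →
              ∃! ψ : cov.tower (i + 1) ≃+* K, ψ y = z ∧
                ∀ a : cov.tower i,
                  ψ (IntermediateField.inclusion hle a) = algebraMap (cov.tower i) K a) ∧
            (∀ σ ∈ cov.gal (i + 1) 1, ∃ τ ∈ cov.gal i 1, ∀ a : cov.tower i,
              σ (IntermediateField.inclusion hle a) =
                IntermediateField.inclusion hle (τ a)) ∧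
            (∀ τ ∈ cov.gal i 1, ∀ e : cov.tower i, Q.eval e = τ d - d →
              ∃! σ : cov.gal (i + 1) 1,
                (∀ a : cov.tower i,
                  (σ : cov.tower (i + 1) ≃ₐ[k] cov.tower (i + 1))
                    (IntermediateField.inclusion hle a) =
                      IntermediateField.inclusion hle (τ a)) ∧
                c.value σ = IntermediateField.inclusion hle e) := by
  have hx := hf.base
  have hreg := hf.base_regular
  refine ⟨cov.tower_one hx hreg, (cov.tower_one hx hreg).trans hx, if_neg (by omega), ?_⟩
  intro i h1 hi
  have hw := hf.pole i h1 hi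
  have hsup := cov.tower_succ_eq_sup hx hreg h1 hi hw
  have hmem : f i ∈ cov.tower (i + 1) := by
    rw [hsup]
    exact (le_sup_right : IntermediateField.adjoin k {f i} ≤ _)
      (IntermediateField.mem_adjoin_simple_self k (f i))
  obtain ⟨y, hyf⟩ : ∃ y : cov.tower (i + 1), (y : F) = f i := ⟨⟨f i, hmem⟩, rfl⟩
  have hy : cov.HasPole (y : F) (cov.mbar i) := hyf ▸ hw
  have hle := cov.tower_le_succ hx hreg h1 hi hy
  have hNΓ := cov.gal_le_gal_one hx hreg i (i + 1)
  obtain ⟨n, hn1, hn⟩ := cov.exists_natCard_gal hx hreg h1 hi hy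
  have hM := cov.isStable_space hx hreg i (cov.mbar i - 1)
  have hM' := cov.isStable_space hx hreg i (p ^ n * cov.mbar i)
  have hM₀ : HKG.IsStable (cov.gal (i + 1) i) (cov.space i (cov.mbar i - 1)) :=
    fun σ hσ => hM σ (hNΓ hσ)
  have hsub := fun σ hσ => cov.sub_mem_space hx hreg hi hy (σ := σ) hσ
  have hDL := cov.eval_stepPoly_mem_L hx hreg h1 hi hy hn hy.1
  have hDT := cov.eval_stepPoly_self_mem_tower hx hreg h1 hi hy
  have hP := cov.induces_stepPoly hx hreg h1 hi hy hn
  refine ⟨y, hle, n, hyf, hn1, hsup, hn, fun σ hσ =>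
    ⟨cov.pow_eq_one_of_mem_gal hx hreg h1 hi hy hσ,
      fun τ hτ => cov.mul_comm_of_mem_gal hx hreg h1 hi hy hσ hτ⟩, hNΓ, hM, hM', hM₀,
    HKG.subCocycle hM y hsub, HKG.subCocycle hM₀ y fun σ hσ => hsub σ (hNΓ hσ),
    fun a ha => cov.mem_tower_of_mem_L hx hreg hi ha, fun _ => rfl, fun _ => rfl,
    fun σ τ h => Subtype.ext (cov.sub_injOn hx hreg h1 hi hy σ.2 τ.2 h),
    fun σ τ => cov.mul_apply_sub hx hreg hi hy σ.2 (hNΓ τ.2),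
    fun c₁ h => HKG.Z1.eq_of_cls_eq (fun σ hσ a ha =>
      cov.mem_gal_iff.1 hσ a (cov.mem_space_iff.1 ha).1) h, ?_,
    ⟨hP, HKG.polyH1_cls_eq_zero hP _ ⟨hDT, hDL⟩ fun σ =>
      cov.eval_stepPoly_apply_sub hx hreg h1 hi hy σ.2⟩, ⟨hDT, hDL⟩, fun D hD => ?_, ?_⟩
  · obtain ⟨a, ha⟩ := cov.exists_stepPoly_eq hx hreg h1 hi hy hn
    have hcoeff : ∀ j < n, (cov.stepPoly y).coeff (p ^ j) = a j := fun j hj => by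
      rw [ha, HKG.coeff_additivePoly p a hj]
    refine ⟨a, ha, fun j hj => ?_, fun hk j hj => ?_⟩
    · rw [← hcoeff j hj]
      exact cov.coeff_stepPoly_mem_adjoin hx hreg h1 hi hy _
    · rw [← hcoeff j hj]
      refine HKG.coeff_finprod_X_sub_C_mem (cov.finite_differences hx hreg h1 hi hy) ?_ _
      rintro _ ⟨σ, rfl⟩
      exact hk σ
  · exact Subtype.forall.trans (cov.forall_eval_eq_iff hx hreg h1 hi hy hD.2 hDL)
  · obtain ⟨Q, d, hQ, hd, hirr, huniv⟩ := cov.exists_polynomial hx hreg h1 hi hy hle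
    refine ⟨Q, d, hQ, hd, hirr, huniv, fun σ hσ => cov.exists_restriction hx hreg hle hσ,
      fun τ hτ e he => cov.existsUnique_extension hx hreg h1 hi hy hle hτ hd ?_⟩
    rw [← he, ← hQ, eval_map]
    exact eval₂_hom (IntermediateField.inclusion hle : cov.tower i →+* cov.tower (i + 1)) e
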